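/- Let $\mathfrak h$ be a separable complex Hilbert space (of finite or infinite dimension) with an anti-linear involution $J$ satisfying $\langle J\phi, J\psi\rangle=\langle\psi,\phi\rangle$. Let $\mathfrak F_A=\mathfrak F_B=\Gamma(\mathfrak h)=\bigoplus_{n\ge 0}\mathfrak h^{\otimes_{\rm sym} n}$ be two copies of the bosonic Fock space, with annihilation and creation operators $A(\phi),A(\phi)^*$ and $B(\phi),B(\phi)^*$ and vacuum $\Omega$. On the Hilbert space tensor product $\mathfrak F_A\otimes\mathfrak F_B$ let $Z(\phi)$ be the closure of $A(\phi)\otimes I+I\otimes B(J\phi)^*$, for $\phi\in\mathfrak h$. Let $\mathcal C$ be the space of classical fields, that is, of anti-linear functionals $\alpha:\mathfrak h\to\mathbb C$, with the smallest $\sigma$-algebra making all evaluations $\alpha\mapsto\alpha(\phi)$ measurable, and let $\mathcal M$ be the commutative $C^*$-algebra of bounded measurable functions $f:\mathcal C\to\mathbb C$ (pointwise operations, supremum norm). 1. There is exactly one unital $*$-homomorphism $\varphi:\mathcal M\to B(\mathfrak F_A\otimes\mathfrak F_B)$, the functional calculus $f\mapsto f(Z^*,Z)$ of the fields, with the following two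 properties. (a) If $(f_n)$ is a uniformly bounded sequence in $\mathcal M$ converging pointwise to $f\in\mathcal M$, then $\varphi(f_n)\to\varphi(f)$ strongly. (b) If $\phi\in\mathfrak h$, $f\in\mathcal M$ and the function $g(\alpha)=\alpha(\phi)f(\alpha)$ is in $\mathcal M$, then $\varphi(f)$ maps into the domain of $Z(\phi)$ and $Z(\phi)\varphi(f)=\varphi(g)$. 2. Let $\mathcal E:B(\mathfrak F_A\otimes\mathfrak F_B)\to B(\mathfrak F_A)$ be the partial vacuum expectation, $\langle u,\mathcal E(X)v\rangle=\langle u\otimes\Omega, X(v\otimes\Omega)\rangle$. Then the anti-Wick quantization $\mathscr A=\mathcal E\circ\varphi:\mathcal M\to B(\mathfrak F_A)$ is completely positive: for every $k$ and every positive matrix $(f_{ij})\in M_k(\mathcal M)$, the matrix $(\mathscr A(f_{ij}))\in M_k(B(\mathfrak F_A))$ is positive. -/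

import Mathlib

open scoped TensorProduct InnerProductSpace ENNReal ComplexConjugate CStarAlgebra

namespace AntiWick
noncomputable section

section TensorPower
variable (h : Type*) [NormedAddCommGroup h] [InnerProductSpace ℂ h]

def AlgTensorPower (n : ℕ) : Type _ := PiTensorProduct ℂ (fun _ : Fin n => h)

instance (n : ℕ) : AddCommGroup (AlgTensorPower h n) :=
  inferInstanceAs (AddCommGroup (PiTensorProduct ℂ (fun _ : Fin n => h)))

instance (n : ℕ) : Module ℂ (AlgTensorPower h n) :=
  inferInstanceAs (Module ℂ (PiTensorProduct ℂ (fun _ : Fin n => h)))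

variable {h}

def simpleTensor (n : ℕ) : MultilinearMap ℂ (fun _ : Fin n => h) (AlgTensorPower h n) :=
  PiTensorProduct.tprod ℂ

def liftTensor {n : ℕ} {V : Type*} [AddCommGroup V] [Module ℂ V]
    (f : MultilinearMap ℂ (fun _ : Fin n => h) V) : AlgTensorPower h n →ₗ[ℂ] V :=
  PiTensorProduct.lift f

@[simp] lemma liftTensor_simpleTensor {n : ℕ} {V : Type*} [AddCommGroup V] [Module ℂ V]
    (f : MultilinearMap ℂ (fun _ : Fin n => h) V) (v : Fin n → h) :
    liftTensor f (simpleTensor n v) = f v :=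
  PiTensorProduct.lift.tprod v

lemma span_simpleTensor (n : ℕ) :
    Submodule.span ℂ (Set.range (simpleTensor (h := h) n)) = ⊤ :=
  PiTensorProduct.span_tprod_eq_top

lemma tensor_induction {n : ℕ} {p : AlgTensorPower h n → Prop}
    (hs : ∀ (c : ℂ) (v : Fin n → h), p (c • simpleTensor n v))
    (ha : ∀ x y, p x → p y → p (x + y)) (x : AlgTensorPower h n) : p x :=
  PiTensorProduct.induction_on x hs ha

/-- The functional `ψ₁ ⊗ ⋯ ⊗ ψₙ ↦ ∏ i, ⟪φ i, ψ i⟫`. -/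
def pairSimple {n : ℕ} (φ : Fin n → h) : AlgTensorPower h n →ₗ[ℂ] ℂ :=
  liftTensor ((MultilinearMap.mkPiAlgebra ℂ (Fin n) ℂ).compLinearMap
    fun i => (innerSL ℂ (φ i)).toLinearMap)

@[simp] lemma pairSimple_simpleTensor {n : ℕ} (φ ψ : Fin n → h) :
    pairSimple φ (simpleTensor n ψ) = ∏ i, ⟪φ i, ψ i⟫_ℂ := by
  simp [pairSimple]

lemma prod_inner_update {n : ℕ} [DecidableEq (Fin n)] (ψ v : Fin n → h) (i : Fin n) (a : h) :
    ∏ j, ⟪Function.update ψ i a j, v j⟫_ℂ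
      = ⟪a, v i⟫_ℂ * ∏ j ∈ Finset.univ.erase i, ⟪ψ j, v j⟫_ℂ := by
  rw [← Finset.mul_prod_erase _ _ (Finset.mem_univ i), Function.update_self]
  congr 1
  refine Finset.prod_congr rfl fun j hj => ?_
  rw [Function.update_of_ne (Finset.ne_of_mem_erase hj)]

/-- The antilinear functional `y ↦ conj ⟪ψ₁ ⊗ ⋯ ⊗ ψₙ, y⟫`, multilinear in `ψ`. -/
def conjPair (n : ℕ) :
    MultilinearMap ℂ (fun _ : Fin n => h) (AlgTensorPower h n →ₗ⋆[ℂ] ℂ) where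
  toFun ψ := (starLinearEquiv ℂ (A := ℂ)).toLinearMap.comp (pairSimple ψ)
  map_update_add' ψ i a b := by
    ext x
    induction x using tensor_induction with
    | hs c v =>
      simp only [LinearMap.comp_apply, map_smulₛₗ, pairSimple_simpleTensor,
        prod_inner_update, LinearMap.add_apply, inner_add_left, add_mul, map_add, smul_add]
    | ha x y hx hy => simp only [map_add, hx, hy]
  map_update_smul' ψ i c a := by
    ext x
    induction x using tensor_induction with
    | hs d v =>
      simp only [LinearMap.comp_apply, map_smulₛₗ, pairSimple_simpleTensor,
        prod_inner_update, LinearMap.smul_apply, inner_smul_left, smul_eq_mul]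
      simp [mul_assoc, mul_left_comm]
    | ha x y hx hy => simp only [map_add, hx, hy]

/-- The sesquilinear form with `⟪φ₁ ⊗ ⋯ ⊗ φₙ, ψ₁ ⊗ ⋯ ⊗ ψₙ⟫ = ∏ i, ⟪φ i, ψ i⟫`. -/
instance instInnerAlg (n : ℕ) : Inner ℂ (AlgTensorPower h n) where
  inner x y := liftTensor (conjPair n) y x

lemma inner_alg_def {n : ℕ} (x y : AlgTensorPower h n) :
    ⟪x, y⟫_ℂ = liftTensor (conjPair n) y x := rfl

lemma inner_simpleTensor {n : ℕ} (φ ψ : Fin n → h) :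
    ⟪simpleTensor n φ, simpleTensor n ψ⟫_ℂ = ∏ i, ⟪φ i, ψ i⟫_ℂ := by
  simp [inner_alg_def, conjPair]

lemma exists_finsupp_rep {n : ℕ} (x : AlgTensorPower h n) :
    ∃ c : (Fin n → h) →₀ ℂ, x = c.sum fun v a => a • simpleTensor n v := by
  have hx : x ∈ Submodule.span ℂ (Set.range (simpleTensor (h := h) n)) := by
    rw [span_simpleTensor]; trivial
  obtain ⟨c, hc⟩ := Finsupp.mem_span_range_iff_exists_finsupp.1 hx
  exact ⟨c, hc.symm⟩

open scoped ComplexOrder Matrix in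
lemma gram_posSemidef {n : ℕ} {ι : Type*} [Finite ι] (v : ι → Fin n → h) :
    (Matrix.of fun a b : ι => ∏ i, ⟪v a i, v b i⟫_ℂ).PosSemidef := by
  classical
  have key : ∀ s : Finset (Fin n),
      (Matrix.of fun a b : ι => ∏ i ∈ s, ⟪v a i, v b i⟫_ℂ).PosSemidef := by
    intro s
    induction s using Finset.induction_on with
    | empty =>
      have := Matrix.posSemidef_gram (𝕜 := ℂ) (fun _ : ι => (1 : ℂ))
      convert! this using 1
      ext a b
      simp [Matrix.gram]
    | insert i s hi ih =>
      have := (Matrix.posSemidef_gram (𝕜 := ℂ) (fun a : ι => v a i)).hadamard ih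
      convert! this using 1
      ext a b
      simp [Matrix.gram, Finset.prod_insert hi]
  exact key Finset.univ

open scoped ComplexOrder in
lemma inner_alg_self_nonneg {n : ℕ} (x : AlgTensorPower h n) : 0 ≤ ⟪x, x⟫_ℂ := by
  obtain ⟨c, rfl⟩ := exists_finsupp_rep x
  have := (gram_posSemidef (h := h) (fun v : c.support => v.1)).dotProduct_mulVec_nonneg
    (fun v => c v.1)
  convert! this using 1
  simp only [inner_alg_def, Finsupp.sum, map_sum, LinearMap.sum_apply, map_smul, map_smulₛₗ,
    LinearMap.smul_apply]
  simp only [← inner_alg_def, inner_simpleTensor, dotProduct, Matrix.mulVec, Finset.mul_sum,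
    smul_eq_mul, Matrix.of_apply, Pi.star_apply]
  rw [← Finset.sum_coe_sort]
  refine Finset.sum_congr rfl fun v _ => ?_
  rw [← Finset.sum_coe_sort]
  refine Finset.sum_congr rfl fun w _ => ?_
  rw [starRingEnd_apply]
  ring

lemma inner_alg_conj_symm {n : ℕ} (x y : AlgTensorPower h n) : conj ⟪y, x⟫_ℂ = ⟪x, y⟫_ℂ := by
  simp only [inner_alg_def]
  induction x using tensor_induction with
  | hs c v =>
    induction y using tensor_induction with
    | hs d w =>
      simp only [map_smul, map_smulₛₗ, LinearMap.smul_apply, ← inner_alg_def, inner_simpleTensor]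
      simp [map_prod, mul_left_comm]
    | ha y z hy hz => simp only [map_add, LinearMap.add_apply, hy, hz]
  | ha y z hy hz => simp only [map_add, LinearMap.add_apply, hy, hz]

@[reducible] def algCore (n : ℕ) : PreInnerProductSpace.Core ℂ (AlgTensorPower h n) where
  inner x y := ⟪x, y⟫_ℂ
  conj_inner_symm := inner_alg_conj_symm
  re_inner_nonneg x := (Complex.le_def.1 (inner_alg_self_nonneg x)).1
  add_left x y z := by simp [inner_alg_def]
  smul_left x y r := by simp [inner_alg_def]

instance (n : ℕ) : SeminormedAddCommGroup (AlgTensorPower h n) :=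
  @InnerProductSpace.Core.toSeminormedAddCommGroup ℂ _ _ _ _ (algCore n)

instance (n : ℕ) : InnerProductSpace ℂ (AlgTensorPower h n) :=
  InnerProductSpace.ofCore (algCore n)

variable (h) in
/-- The `n`-th Hilbert space tensor power of `h`. -/
abbrev TensorPower (n : ℕ) : Type _ := UniformSpace.Completion (AlgTensorPower h n)

/-- The elementary tensor `φ₁ ⊗ ⋯ ⊗ φₙ` in the Hilbert space tensor power. -/
def elemTensor {n : ℕ} (φ : Fin n → h) : TensorPower h n :=
  ((simpleTensor n φ : AlgTensorPower h n) : TensorPower h n)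

variable (h) in
/-- The symmetric tensor power: the closed linear span of the symmetrised elementary tensors
`∑ σ, φ_{σ 1} ⊗ ⋯ ⊗ φ_{σ n}`. -/
def symPower (n : ℕ) : Submodule ℂ (TensorPower h n) :=
  (Submodule.span ℂ (Set.range fun φ : Fin n → h =>
    ∑ σ : Equiv.Perm (Fin n), elemTensor (φ ∘ σ))).topologicalClosure

instance (n : ℕ) : CompleteSpace (symPower h n) :=
  (Submodule.isClosed_topologicalClosure _).completeSpace_coe

/-- The map `ψ₁ ⊗ ⋯ ⊗ ψₙ ↦ φ ⊗ ψ₁ ⊗ ⋯ ⊗ ψₙ` on algebraic tensors. -/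
def algConsTensor (φ : h) (n : ℕ) : AlgTensorPower h n →ₗ[ℂ] AlgTensorPower h (n + 1) :=
  liftTensor ((simpleTensor (n + 1)).curryLeft φ)

lemma inner_algConsTensor (φ : h) {n : ℕ} (x y : AlgTensorPower h n) :
    ⟪algConsTensor φ n x, algConsTensor φ n y⟫_ℂ = ⟪φ, φ⟫_ℂ * ⟪x, y⟫_ℂ := by
  induction x using tensor_induction with
  | hs c v =>
    induction y using tensor_induction with
    | hs d w =>
      simp only [map_smul, inner_smul_left, inner_smul_right, algConsTensor,
        liftTensor_simpleTensor, MultilinearMap.curryLeft_apply]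
      rw [inner_simpleTensor, inner_simpleTensor]
      simp only [Fin.prod_univ_succ, Fin.cons_zero, Fin.cons_succ]
      ring
    | ha y z hy hz => simp only [map_add, inner_add_right, hy, hz, mul_add]
  | ha y z hy hz => simp only [map_add, inner_add_left, hy, hz, mul_add]

lemma norm_algConsTensor (φ : h) {n : ℕ} (x : AlgTensorPower h n) :
    ‖algConsTensor φ n x‖ = ‖φ‖ * ‖x‖ := by
  have h1 := inner_algConsTensor φ x x
  simp only [inner_self_eq_norm_sq_to_K] at h1
  have h2 : ‖algConsTensor φ n x‖ ^ 2 = (‖φ‖ * ‖x‖) ^ 2 := by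
    rw [mul_pow]; exact_mod_cast h1
  exact (sq_eq_sq₀ (norm_nonneg _) (by positivity)).1 h2

/-- The bounded operator `x ↦ φ ⊗ x` from the `n`-th to the `(n+1)`-st tensor power. -/
def consTensor (φ : h) (n : ℕ) : TensorPower h n →L[ℂ] TensorPower h (n + 1) :=
  ((UniformSpace.Completion.toComplL (𝕜 := ℂ) (E := AlgTensorPower h (n + 1))).comp
    ((algConsTensor φ n).mkContinuous ‖φ‖ fun x => (norm_algConsTensor φ x).le)).extend
      (UniformSpace.Completion.toComplL (𝕜 := ℂ) (E := AlgTensorPower h n))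

lemma consTensor_elemTensor (φ : h) {n : ℕ} (ψ : Fin n → h) :
    consTensor φ n (elemTensor ψ) = elemTensor (Fin.cons φ ψ : Fin (n + 1) → h) := by
  refine (ContinuousLinearMap.extend_eq _ ?_ ?_ _).trans ?_
  · exact UniformSpace.Completion.denseRange_coe
  · exact UniformSpace.Completion.isUniformInducing_coe _
  · simp [elemTensor, algConsTensor]

/-- The creation operator on the `n`-particle space: `x ↦ √(n+1) P(φ ⊗ x)`, where `P` is the
orthogonal projection onto the symmetric tensors. -/
def creationLevel (φ : h) (n : ℕ) : symPower h n →L[ℂ] symPower h (n + 1) :=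
  (Real.sqrt (n + 1) : ℂ) •
    ((symPower h (n + 1)).orthogonalProjectionOnto ∘L consTensor φ n ∘L (symPower h n).subtypeL)

/-- The annihilation operator on the `(n+1)`-particle space, the adjoint of `creationLevel`. -/
def annihilationLevel (φ : h) (n : ℕ) : symPower h (n + 1) →L[ℂ] symPower h n :=
  ContinuousLinearMap.adjoint (creationLevel φ n)

end TensorPower

section Fock
variable (h : Type*) [NormedAddCommGroup h] [InnerProductSpace ℂ h]

/-- The bosonic Fock space over `h`: the Hilbert space direct sum of the symmetric tensor powers. -/
def Fock : Type _ := lp (fun n : ℕ => symPower h n) 2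

instance : NormedAddCommGroup (Fock h) :=
  inferInstanceAs (NormedAddCommGroup (lp (fun n : ℕ => symPower h n) 2))

instance : InnerProductSpace ℂ (Fock h) :=
  inferInstanceAs (InnerProductSpace ℂ (lp (fun n : ℕ => symPower h n) 2))

instance : CompleteSpace (Fock h) :=
  inferInstanceAs (CompleteSpace (lp (fun n : ℕ => symPower h n) 2))

lemma elemTensor_zero_mem : elemTensor (h := h) (n := 0) ![] ∈ symPower h 0 :=
  Submodule.le_topologicalClosure _ (Submodule.subset_span ⟨![], by
    simp [Matrix.empty_eq]⟩)

/-- The Fock vacuum: the unit vector `1 ∈ ℂ`, in the zero-particle space. -/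
def vacuum : Fock h :=
  lp.single (E := fun n : ℕ => symPower h n) 2 0 ⟨elemTensor ![], elemTensor_zero_mem h⟩

variable {h}

def creationSeq (φ : h) : Fock h →ₗ[ℂ] PreLp (fun n : ℕ => symPower h n) where
  toFun x := fun n => match n with
    | 0 => 0
    | n + 1 => creationLevel φ n (x.1 n)
  map_add' x y := by
    funext n
    cases n with
    | zero => exact (add_zero 0).symm
    | succ n => exact map_add (creationLevel φ n) (x.1 n) (y.1 n)
  map_smul' c x := by
    funext n
    cases n with
    | zero => exact (smul_zero c).symm
    | succ n => exact map_smul (creationLevel φ n) c (x.1 n)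

def annihilationSeq (φ : h) : Fock h →ₗ[ℂ] PreLp (fun n : ℕ => symPower h n) where
  toFun x := fun n => annihilationLevel φ n (x.1 (n + 1))
  map_add' x y := by
    funext n
    exact map_add (annihilationLevel φ n) (x.1 (n + 1)) (y.1 (n + 1))
  map_smul' c x := by
    funext n
    exact map_smul (annihilationLevel φ n) c (x.1 (n + 1))

/-- The operator on Fock space acting by a linear map into sequences of `n`-particle vectors, with
its maximal domain (the vectors whose image is square summable). -/
def maximalOperator (T : Fock h →ₗ[ℂ] PreLp (fun n : ℕ => symPower h n)) :
    Fock h →ₗ.[ℂ] Fock h where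
  domain := (lpSubmodule ℂ (fun n : ℕ => symPower h n) 2).comap T
  toFun :=
    { toFun := fun x => (⟨T x, x.2⟩ : lp (fun n : ℕ => symPower h n) 2)
      map_add' := fun x y => Subtype.ext (map_add T (x : Fock h) (y : Fock h))
      map_smul' := fun c x => Subtype.ext (map_smul T c (x : Fock h)) }

/-- The creation operator `A(φ)*` on Fock space, a closed operator. -/
def creation (φ : h) : Fock h →ₗ.[ℂ] Fock h := maximalOperator (creationSeq φ)

/-- The annihilation operator `A(φ)` on Fock space, a closed operator. -/
def annihilation (φ : h) : Fock h →ₗ.[ℂ] Fock h := maximalOperator (annihilationSeq φ)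

variable (h) in
/-- The Hilbert space tensor product of two copies of the Fock space. -/
abbrev DoubleFock : Type _ := UniformSpace.Completion (Fock h ⊗[ℂ] Fock h)

/-- The elementary tensor `u ⊗ v` in the Hilbert space tensor product. -/
def pureTensor (u v : Fock h) : DoubleFock h :=
  ((u ⊗ₜ[ℂ] v : Fock h ⊗[ℂ] Fock h) : DoubleFock h)

/-- The field `Z(φ) = A(φ) ⊗ I + I ⊗ B(J φ)*`: the closure of the operator that is defined on the
algebraic tensor product of the domains of `A(φ)` and `B(J φ)*`. -/
def fieldZ (J : h → h) (φ : h) : DoubleFock h →ₗ.[ℂ] DoubleFock h :=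
  (Submodule.span ℂ (Set.range fun p : (annihilation φ).domain × (creation (J φ)).domain =>
    (pureTensor (p.1 : Fock h) (p.2 : Fock h),
      pureTensor (annihilation φ p.1) (p.2 : Fock h)
        + pureTensor (p.1 : Fock h) (creation (J φ) p.2)))).topologicalClosure.toLinearPMap

variable (h) in
/-- The isometry `u ↦ u ⊗ Ω`. -/
def vacuumEmbedding : Fock h →L[ℂ] DoubleFock h :=
  (UniformSpace.Completion.toComplL (𝕜 := ℂ) (E := Fock h ⊗[ℂ] Fock h)).comp
    (LinearMap.mkContinuous ((TensorProduct.mk ℂ (Fock h) (Fock h)).flip (vacuum h)) ‖vacuum h‖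
      fun u => by simp [mul_comm])

variable (h) in
/-- The partial vacuum expectation `X ↦ V* X V` with `V u = u ⊗ Ω`, that is,
`⟪u, 𝓔(X) v⟫ = ⟪u ⊗ Ω, X (v ⊗ Ω)⟫`. -/
def vacuumExpectation :
    (DoubleFock h →L[ℂ] DoubleFock h) →ₗ[ℂ] (Fock h →L[ℂ] Fock h) where
  toFun X := ContinuousLinearMap.adjoint (vacuumEmbedding h) ∘L X ∘L vacuumEmbedding h
  map_add' X Y := by ext; simp
  map_smul' c X := by ext; simp

lemma inner_vacuumExpectation (X : DoubleFock h →L[ℂ] DoubleFock h) (u v : Fock h) :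
    ⟪u, vacuumExpectation h X v⟫_ℂ
      = ⟪pureTensor u (vacuum h), X (pureTensor v (vacuum h))⟫_ℂ := by
  simp only [vacuumExpectation, LinearMap.coe_mk, AddHom.coe_mk, ContinuousLinearMap.comp_apply,
    ContinuousLinearMap.adjoint_inner_right]
  rfl

end Fock

section Functions

/-- The algebra of bounded measurable complex-valued functions, with the pointwise operations and
the supremum norm. -/
def boundedMeasurable (Ω : Type*) [MeasurableSpace Ω] :
    StarSubalgebra ℂ (lp (fun _ : Ω => ℂ) ∞) where
  carrier := {f | Measurable fun ω => f ω}
  mul_mem' hf hg := hf.mul hg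
  one_mem' := measurable_const
  add_mem' hf hg := hf.add hg
  zero_mem' := measurable_const
  algebraMap_mem' _ := measurable_const
  star_mem' hf := Complex.continuous_conj.measurable.comp hf

variable {Ω : Type*} [MeasurableSpace Ω]

instance : CommCStarAlgebra (lp (fun _ : Ω => ℂ) ∞) where

instance : IsClosed (boundedMeasurable Ω : Set (lp (fun _ : Ω => ℂ) ∞)) := by
  refine IsSeqClosed.isClosed fun f g hf hfg => ?_
  refine measurable_of_tendsto_metrizable hf (tendsto_pi_nhds.2 fun ω => ?_)
  rw [tendsto_iff_norm_sub_tendsto_zero] at hfg ⊢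
  exact squeeze_zero (fun _ => norm_nonneg _)
    (fun n => lp.norm_apply_le_norm (by simp) (f n - g) ω) hfg

open scoped ComplexOrder in
/-- The pointwise order. -/
instance : PartialOrder (boundedMeasurable Ω) :=
  PartialOrder.lift (fun f => (f.1 : Ω → ℂ)) fun _ _ hfg => Subtype.ext (lp.ext hfg)

open scoped ComplexOrder in
instance : StarOrderedRing (boundedMeasurable Ω) := by
  refine StarOrderedRing.of_nonneg_iff' (fun {f g} hfg k ω => ?_) fun f => ⟨fun hf => ?_, ?_⟩
  · exact add_le_add_right (hfg ω) _
  · have hf0 : ∀ ω, 0 ≤ f.1 ω := hf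
    have hb : ∀ ω, ‖((Real.sqrt (f.1 ω).re : ℝ) : ℂ)‖ ≤ Real.sqrt ‖f.1‖ := fun ω => by
      rw [Complex.norm_real, Real.norm_of_nonneg (Real.sqrt_nonneg _)]
      exact Real.sqrt_le_sqrt ((Complex.re_le_norm _).trans
        (lp.norm_apply_le_norm (by simp) f.1 ω))
    refine ⟨⟨⟨fun ω => ((Real.sqrt (f.1 ω).re : ℝ) : ℂ), memℓp_infty ⟨Real.sqrt ‖f.1‖, ?_⟩⟩, ?_⟩, ?_⟩
    · rintro _ ⟨ω, rfl⟩
      exact hb ω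
    · have hm : Measurable fun ω => f.1 ω := f.2
      exact Complex.measurable_ofReal.comp (Complex.measurable_re.comp hm).sqrt
    · refine Subtype.ext (lp.ext (funext fun ω => ?_))
      change f.1 ω = star ((Real.sqrt (f.1 ω).re : ℝ) : ℂ) * ((Real.sqrt (f.1 ω).re : ℝ) : ℂ)
      rw [RCLike.star_def, Complex.conj_ofReal, ← Complex.ofReal_mul,
        Real.mul_self_sqrt (Complex.le_def.1 (hf0 ω)).1]
      exact Complex.ext rfl (Complex.le_def.1 (hf0 ω)).2.symm
  · rintro ⟨s, rfl⟩ ω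
    exact star_mul_self_nonneg (s.1 ω)

end Functions

section Quantization
variable (h : Type*) [NormedAddCommGroup h] [InnerProductSpace ℂ h]

/-- A classical (complex) field configuration: an antilinear functional `φ ↦ α(φ)`. -/
abbrev ClassicalField : Type _ := h →ₗ⋆[ℂ] ℂ

/-- The smallest σ-algebra that makes all the fields `α ↦ α(φ)` measurable. -/
instance : MeasurableSpace (ClassicalField h) :=
  ⨆ φ : h, MeasurableSpace.comap (fun α : ClassicalField h => α φ) inferInstance

variable {h}

/-- `Φ` is the joint (bounded measurable) functional calculus `f ↦ f(Z, Z*)` of the family of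
fields `Z(φ)`: a unital `*`-homomorphism that is continuous for bounded pointwise convergence and
replaces the classical field `α(φ)` by the operator `Z(φ)`, i.e. `Z(φ) Φ(f) = Φ(α(φ) f)` whenever
both `f` and `α(φ) f` are bounded. -/
structure IsFieldCalculus (J : h → h)
    (Φ : boundedMeasurable (ClassicalField h) →⋆ₐ[ℂ] (DoubleFock h →L[ℂ] DoubleFock h)) :
    Prop where
  tendsto : ∀ (f : ℕ → boundedMeasurable (ClassicalField h))
    (g : boundedMeasurable (ClassicalField h)) (C : ℝ), (∀ n, ‖f n‖ ≤ C) →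
    (∀ α, Filter.Tendsto (fun n => (f n).1 α) Filter.atTop (nhds (g.1 α))) →
    ∀ x, Filter.Tendsto (fun n => Φ (f n) x) Filter.atTop (nhds (Φ g x))
  field : ∀ (φ : h) (f g : boundedMeasurable (ClassicalField h)),
    (∀ α, g.1 α = α φ * f.1 α) →
    ∀ x, ∃ hx : Φ f x ∈ (fieldZ J φ).domain, fieldZ J φ ⟨Φ f x, hx⟩ = Φ g x

/-- The anti-Wick quantization `𝓐 = 𝓔 ∘ Φ`. -/
def antiWick (Φ : boundedMeasurable (ClassicalField h) →⋆ₐ[ℂ] (DoubleFock h →L[ℂ] DoubleFock h)) :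
    boundedMeasurable (ClassicalField h) →ₗ[ℂ] (Fock h →L[ℂ] Fock h) :=
  vacuumExpectation h ∘ₗ Φ.toAlgHom.toLinearMap

end Quantization

end
end AntiWick

/-! The double Fock space is the `L²` space of a Gaussian measure in disguise, and there the fields
`Z(φ)` are multiplication operators. Take independent standard complex Gaussian variables indexed by
a Hilbert basis of `h`, and let `z` be the antilinear Gaussian field they define. The vectors
`exp(φ) ⊗ exp(Jη)` have the inner products `exp(⟪φ, φ'⟫ + ⟪η', η⟫)`, and so do the Wick exponentials
`exp(conj z(φ) + z(η) - ⟪η, φ⟫)`. Both families are total: the first by polarization and uniqueness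
of power series coefficients, the second by uniqueness of the Fourier transform. Hence
`exists_unitary_of_gram` yields a unitary between the two spaces.

Under this unitary the closed operator `Z(φ)` is multiplication by `z(φ)` on its maximal domain
(`exists_gaussian_representation`). That it is a restriction of the multiplication operator follows
from the adjoint relation on exponential vectors. That nothing is missing holds because a vector of
the multiplication graph orthogonal to the graph of `Z(φ)` satisfies `(1 + |z|²) w = 0`.

Existence: `z` has a version `T` with values in the antilinear functionals, and `f` acts as
multiplication by `f ∘ T`; dominated convergence gives the continuity.

Uniqueness: let `P` be another calculus, moved to the model, and `Q` multiplication by `f ∘ T`. For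
a disc `D = {‖α(φ) - c‖ ≤ R}` the functions `1_D (α(φ) - c)ⁿ` have norm at most `Rⁿ` and `P` is
contractive, so the range of `P(1_D)` lives on `‖z(φ) - c‖ ≤ R`, that is, `P(1_D) ≤ Q(1_D)`.
Countable unions give the same for the open complement of `D`, and since both pairs of projections
sum to `1`, equality holds on discs. Discs generate the σ-algebra.

Complete positivity: a `*`-homomorphism is completely positive, and so is the compression by the
isometry `u ↦ u ⊗ Ω`. -/

namespace AntiWick
noncomputable section

attribute [-instance] CStarModule.toInner

/-! ### Polarization identity for symmetrised sums -/

section Polarization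

/-- Inclusion–exclusion over the subsets of the index set picks out the permutations. -/
lemma sum_perm_eq_sum_powerset {n : ℕ} (c : (Fin n → Fin n) → ℂ) :
    ∑ σ : Equiv.Perm (Fin n), c σ
      = (-1) ^ n * ∑ s : Finset (Fin n), (-1) ^ s.card *
          ∑ f ∈ Fintype.piFinset fun _ : Fin n => s, c f := by
  classical
  have hmem : ∀ (s : Finset (Fin n)) (f : Fin n → Fin n),
      f ∈ Fintype.piFinset (fun _ => s) ↔ Finset.univ.image f ⊆ s := fun s f => by
    simp [Fintype.mem_piFinset, Finset.subset_iff]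
  -- For a fixed `f`, the alternating sum over the supersets of its image vanishes unless the image
  -- is everything.
  have hcompl : ∀ f : Fin n → Fin n,
      (∑ s : Finset (Fin n), if Finset.univ.image f ⊆ s then ((-1 : ℂ)) ^ s.card else 0)
        = if Function.Bijective f then (-1) ^ n else 0 := fun f => by
    have h1 : (∑ s : Finset (Fin n), if Finset.univ.image f ⊆ s then ((-1 : ℂ)) ^ s.card else 0)
        = ∑ s ∈ (Finset.univ.image f)ᶜ.powerset, (-1) ^ n * (-1) ^ s.card := by
      rw [← Finset.sum_filter]
      refine Finset.sum_bij' (fun s _ => sᶜ) (fun s _ => sᶜ) ?_ ?_ ?_ ?_ ?_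
      · intro s hs
        simpa using hs
      · intro s hs
        simp only [Finset.mem_powerset] at hs
        simpa [Finset.subset_compl_comm] using hs
      · simp
      · simp
      · intro s _
        have h : s.card + sᶜ.card = n := by
          rw [Finset.card_add_card_compl, Fintype.card_fin]
        have h' : ((-1 : ℂ)) ^ n = (-1) ^ s.card * (-1) ^ sᶜ.card := by rw [← pow_add, h]
        rw [h', mul_assoc, ← mul_pow]
        simp
    rw [h1, ← Finset.mul_sum]
    have h2 := Finset.sum_powerset_neg_one_pow_card (x := (Finset.univ.image f)ᶜ)
    have h3 : (∑ s ∈ (Finset.univ.image f)ᶜ.powerset, ((-1 : ℂ)) ^ s.card)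
        = if (Finset.univ.image f)ᶜ = ∅ then 1 else 0 := by
      exact_mod_cast congrArg (Int.cast : ℤ → ℂ) h2
    rw [h3]
    have h4 : (Finset.univ.image f)ᶜ = ∅ ↔ Function.Bijective f := by
      rw [Finset.compl_eq_empty_iff, ← Finset.coe_eq_univ, Finset.coe_image, Finset.coe_univ, Set.image_univ,
        Set.range_eq_univ]
      exact Finite.injective_iff_surjective.symm.trans Finite.injective_iff_bijective
    simp [h4]
  have hsum : ∑ s : Finset (Fin n), (-1 : ℂ) ^ s.card *
      ∑ f ∈ Fintype.piFinset (fun _ : Fin n => s), c f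
        = ∑ f : Fin n → Fin n, (if Function.Bijective f then (-1) ^ n else 0) * c f := by
    simp_rw [← hcompl, Finset.sum_mul, Finset.mul_sum]
    rw [Finset.sum_comm]
    refine Finset.sum_congr rfl fun s _ => ?_
    have h5 : Fintype.piFinset (fun _ : Fin n => s)
        = Finset.univ.filter fun f : Fin n → Fin n => Finset.univ.image f ⊆ s := by
      ext f
      rw [hmem]
      simp
    rw [h5, Finset.sum_filter]
    refine Finset.sum_congr rfl fun f _ => ?_
    split_ifs <;> simp
  rw [hsum]
  simp only [ite_mul, zero_mul]
  rw [← Finset.sum_filter, ← Finset.mul_sum, ← mul_assoc, ← mul_pow]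
  simp only [mul_neg, mul_one, neg_neg, one_pow, one_mul]
  refine Finset.sum_bij (fun σ _ => (σ : Fin n → Fin n)) (fun σ _ => ?_) (fun σ _ τ _ hστ => ?_)
    (fun f hf => ?_) fun σ _ => rfl
  · exact Finset.mem_filter.2 ⟨Finset.mem_univ _, σ.bijective⟩
  · exact DFunLike.coe_injective hστ
  · exact ⟨Equiv.ofBijective f (by simpa using hf), Finset.mem_univ _, rfl⟩

end Polarization

/-! ### Exponential vectors and their totality -/

section FockExp
variable {h : Type*} [NormedAddCommGroup h] [InnerProductSpace ℂ h]

lemma inner_elemTensor {n : ℕ} (φ ψ : Fin n → h) :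
    ⟪elemTensor φ, elemTensor ψ⟫_ℂ = ∏ i, ⟪φ i, ψ i⟫_ℂ := by
  rw [elemTensor, elemTensor, UniformSpace.Completion.inner_coe, inner_simpleTensor]

lemma elemTensor_const_mem (φ : h) (n : ℕ) :
    elemTensor (fun _ : Fin n => φ) ∈ symPower h n := by
  have h1 : ∑ σ : Equiv.Perm (Fin n), elemTensor ((fun _ : Fin n => φ) ∘ σ) ∈ symPower h n :=
    Submodule.le_topologicalClosure _ (Submodule.subset_span ⟨_, rfl⟩)
  have h2 : ∑ σ : Equiv.Perm (Fin n), elemTensor ((fun _ : Fin n => φ) ∘ σ)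
      = (n.factorial : ℂ) • elemTensor (fun _ : Fin n => φ) := by
    simp [Function.comp_def, Fintype.card_perm, Nat.cast_smul_eq_nsmul]
  rw [h2] at h1
  exact (Submodule.smul_mem_iff _ (by exact_mod_cast n.factorial_ne_zero)).1 h1

/-- The power `φ ⊗ ⋯ ⊗ φ`. -/
def powTensor (φ : h) (n : ℕ) : symPower h n :=
  ⟨elemTensor fun _ => φ, elemTensor_const_mem φ n⟩

lemma inner_powTensor (φ ψ : h) (n : ℕ) : ⟪powTensor φ n, powTensor ψ n⟫_ℂ = ⟪φ, ψ⟫_ℂ ^ n := by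
  rw [Submodule.coe_inner]
  simp [powTensor, inner_elemTensor]

lemma inner_smul_left_symPower {n : ℕ} (c : ℂ) (x y : symPower h n) :
    ⟪c • x, y⟫_ℂ = conj c * ⟪x, y⟫_ℂ := inner_smul_left x y c

lemma inner_smul_right_symPower {n : ℕ} (c : ℂ) (x y : symPower h n) :
    ⟪x, c • y⟫_ℂ = c * ⟪x, y⟫_ℂ := inner_smul_right x y c

lemma norm_powTensor (φ : h) (n : ℕ) : ‖powTensor φ n‖ = ‖φ‖ ^ n := by
  have h1 := inner_powTensor φ φ n
  rw [inner_self_eq_norm_sq_to_K, inner_self_eq_norm_sq_to_K] at h1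
  have h2 : ‖powTensor φ n‖ ^ 2 = (‖φ‖ ^ n) ^ 2 := by
    rw [← pow_mul, mul_comm n 2, pow_mul]
    exact Complex.ofReal_injective (by push_cast; exact h1)
  exact (sq_eq_sq₀ (norm_nonneg _) (by positivity)).1 h2

lemma norm_inv_sqrt_factorial_sq (n : ℕ) :
    ‖((Real.sqrt n.factorial : ℂ))⁻¹‖ ^ 2 = (n.factorial : ℝ)⁻¹ := by
  rw [norm_inv, Complex.norm_real, inv_pow, Real.norm_of_nonneg (Real.sqrt_nonneg _),
    Real.sq_sqrt (by positivity)]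

/-- The exponential vector `⨁ₙ φ^{⊗n} / √n!`. -/
def expVec (φ : h) : Fock h :=
  (⟨fun n => ((Real.sqrt n.factorial : ℂ))⁻¹ • powTensor φ n, by
    refine memℓp_gen ?_
    simp only [ENNReal.toReal_ofNat, Real.rpow_ofNat, norm_smul, mul_pow,
      norm_inv_sqrt_factorial_sq, norm_powTensor]
    refine (Real.summable_pow_div_factorial (‖φ‖ ^ 2)).congr fun n => ?_
    rw [← pow_mul, ← pow_mul, mul_comm n 2]; ring⟩ :
      lp (fun n : ℕ => symPower h n) 2)

/-- The `n`-particle component. -/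
def level (n : ℕ) : Fock h →ₗ[ℂ] symPower h n where
  toFun x := x.1 n
  map_add' _ _ := rfl
  map_smul' _ _ := rfl

lemma fock_ext {x y : Fock h} (hxy : ∀ n, level n x = level n y) : x = y :=
  Subtype.ext (funext hxy)

lemma level_expVec (φ : h) (n : ℕ) :
    level n (expVec φ) = ((Real.sqrt n.factorial : ℂ))⁻¹ • powTensor φ n := rfl

lemma hasSum_inner_fock (x y : Fock h) : HasSum (fun n => ⟪level n x, level n y⟫_ℂ) ⟪x, y⟫_ℂ :=
  lp.hasSum_inner (G := fun n : ℕ => symPower h n) x y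

lemma inv_sqrt_factorial_mul_self (n : ℕ) :
    ((Real.sqrt n.factorial : ℂ))⁻¹ * ((Real.sqrt n.factorial : ℂ))⁻¹ = (n.factorial : ℂ)⁻¹ := by
  rw [← mul_inv, ← Complex.ofReal_mul, Real.mul_self_sqrt (by positivity), Complex.ofReal_natCast]

lemma inner_expVec (φ ψ : h) : ⟪expVec φ, expVec ψ⟫_ℂ = Complex.exp ⟪φ, ψ⟫_ℂ := by
  refine (hasSum_inner_fock _ _).unique ?_
  rw [Complex.exp_eq_exp_ℂ]
  refine (NormedSpace.exp_series_hasSum_exp' (𝕂 := ℂ) (⟪φ, ψ⟫_ℂ)).congr_fun fun n => ?_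
  rw [level_expVec, level_expVec, inner_smul_left_symPower, inner_smul_right_symPower, inner_powTensor, map_inv₀,
    Complex.conj_ofReal, ← mul_assoc, inv_sqrt_factorial_mul_self, smul_eq_mul]

lemma norm_expVec_sq (φ : h) : ‖expVec φ‖ ^ 2 = Real.exp (‖φ‖ ^ 2) := by
  have h1 := inner_expVec φ φ
  rw [inner_self_eq_norm_sq_to_K, inner_self_eq_norm_sq_to_K] at h1
  refine Complex.ofReal_injective ?_
  push_cast
  exact h1

/-- The reproducing kernel makes `‖expVec ψ - expVec φ‖` an explicit continuous function of `ψ` that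
vanishes at `φ`. -/
lemma continuous_expVec : Continuous (expVec : h → Fock h) := by
  rw [continuous_iff_continuousAt]
  intro φ
  rw [ContinuousAt, tendsto_iff_norm_sub_tendsto_zero]
  have h1 : ∀ ψ : h, ‖expVec ψ - expVec φ‖
      = Real.sqrt (Real.exp (‖ψ‖ ^ 2) - 2 * (Complex.exp ⟪ψ, φ⟫_ℂ).re + Real.exp (‖φ‖ ^ 2)) :=
    fun ψ => by
      have h2 := norm_sub_sq (𝕜 := ℂ) (expVec ψ) (expVec φ)
      rw [inner_expVec, norm_expVec_sq, norm_expVec_sq] at h2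
      rw [← RCLike.re_eq_complex_re, ← h2, Real.sqrt_sq (norm_nonneg _)]
  simp_rw [h1]
  have h2 : Continuous fun ψ : h =>
      Real.sqrt (Real.exp (‖ψ‖ ^ 2) - 2 * (Complex.exp ⟪ψ, φ⟫_ℂ).re + Real.exp (‖φ‖ ^ 2)) := by
    fun_prop
  have h3 := h2.tendsto φ
  rw [← h1, sub_self, norm_zero] at h3
  exact h3

lemma powTensor_smul (c : ℂ) (φ : h) (n : ℕ) : powTensor (c • φ) n = c ^ n • powTensor φ n := by
  refine Subtype.ext ?_
  change ((simpleTensor n (fun _ => c • φ) : AlgTensorPower h n) : TensorPower h n)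
    = c ^ n • ((simpleTensor n (fun _ => φ) : AlgTensorPower h n) : TensorPower h n)
  rw [← UniformSpace.Completion.coe_smul]
  congr 1
  have := (simpleTensor (h := h) n).map_smul_univ (fun _ => c) (fun _ => φ)
  simpa using this

lemma elemTensor_sum {n : ℕ} (φ : Fin n → h) (s : Finset (Fin n)) :
    elemTensor (fun _ : Fin n => ∑ i ∈ s, φ i)
      = ∑ f ∈ Fintype.piFinset fun _ : Fin n => s, elemTensor (φ ∘ f) := by
  have h1 := (simpleTensor (h := h) n).map_sum_finset (fun _ i => φ i) (fun _ => s)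
  have h2 := congrArg
    (UniformSpace.Completion.toComplL (𝕜 := ℂ) (E := AlgTensorPower h n)) h1
  rw [map_sum] at h2
  exact h2

/-- By polarization each symmetrised elementary tensor is a signed sum of powers of partial sums `∑
i ∈ s, φ i`, so the generators of `symPower h n` are orthogonal to `y`, and then `y` is orthogonal
to itself. -/
lemma eq_zero_of_inner_powTensor {n : ℕ} (y : symPower h n)
    (hy : ∀ φ, ⟪powTensor φ n, y⟫_ℂ = 0) : y = 0 := by
  have h1 : symPower h n ≤ (ℂ ∙ (y : TensorPower h n))ᗮ := by
    refine Submodule.topologicalClosure_minimal _ ?_ (Submodule.isClosed_orthogonal _)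
    rw [Submodule.span_le]
    rintro _ ⟨φ, rfl⟩
    rw [SetLike.mem_coe, Submodule.mem_orthogonal_singleton_iff_inner_left, sum_inner,
      sum_perm_eq_sum_powerset (fun f => ⟪elemTensor (φ ∘ f), (y : TensorPower h n)⟫_ℂ)]
    refine mul_eq_zero_of_right _ (Finset.sum_eq_zero fun s _ => ?_)
    rw [← sum_inner, ← elemTensor_sum]
    exact mul_eq_zero_of_right _ (hy (∑ i ∈ s, φ i))
  have h2 := h1 y.2
  rw [Submodule.mem_orthogonal_singleton_iff_inner_left, inner_self_eq_zero] at h2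
  exact Subtype.ext h2

/-- Along a complex line of vectors `φ` the pairing is a power series whose coefficients are the
pairings of the levels of `x` with the powers of `φ`; it vanishes identically, so they all do. -/
lemma eq_zero_of_inner_expVec (x : Fock h) (hx : ∀ φ, ⟪expVec φ, x⟫_ℂ = 0) : x = 0 := by
  refine fock_ext fun n => ?_
  refine eq_zero_of_inner_powTensor _ fun φ => ?_
  set a : ℕ → ℂ := fun n => ((Real.sqrt n.factorial : ℂ))⁻¹ * ⟪powTensor φ n, level n x⟫_ℂ
  have h1 : ∀ t : ℂ, HasSum (fun n => t ^ n • a n) 0 := fun t => by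
    -- The conjugate makes the pairing holomorphic in `t`, as the inner product is antilinear in the
    -- first slot.
    have := hasSum_inner_fock (expVec (conj t • φ)) x
    rw [hx] at this
    refine this.congr_fun fun n => ?_
    rw [level_expVec, powTensor_smul, inner_smul_left_symPower, inner_smul_left_symPower]
    simp [a]
    ring
  have h2 : HasFPowerSeriesAt (0 : ℂ → ℂ) (FormalMultilinearSeries.ofScalars ℂ a) 0 := by
    rw [hasFPowerSeriesAt_iff]
    refine Filter.Eventually.of_forall fun t => ?_
    simpa using h1 t
  have h3 := h2.eq_zero
  have h4 : a n = 0 := by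
    have := congrArg (fun p => p.coeff n) h3
    rw [FormalMultilinearSeries.coeff_ofScalars] at this
    exact this.trans rfl
  have h5 : ((Real.sqrt n.factorial : ℂ))⁻¹ ≠ 0 := by
    have : (0 : ℝ) < Real.sqrt n.factorial := Real.sqrt_pos.2 (by positivity)
    exact inv_ne_zero (by exact_mod_cast this.ne')
  exact (mul_eq_zero.1 h4).resolve_left h5

lemma expVec_zero : expVec (0 : h) = vacuum h := by
  refine fock_ext fun n => ?_
  cases n with
  | zero =>
    have h1 : level 0 (vacuum h) = ⟨elemTensor ![], elemTensor_zero_mem h⟩ :=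
      lp.single_apply_self (E := fun n : ℕ => symPower h n) 2 0 _
    rw [level_expVec, h1]
    refine Subtype.ext ?_
    simp [powTensor]
    congr 1
    exact Subsingleton.elim _ _
  | succ n =>
    have h1 : level (n + 1) (vacuum h) = 0 :=
      lp.single_apply_ne (E := fun n : ℕ => symPower h n) 2 0
        (⟨elemTensor ![], elemTensor_zero_mem h⟩ : symPower h 0) (Nat.succ_ne_zero n)
    rw [level_expVec, h1]
    have : powTensor (0 : h) (n + 1) = 0 := by
      rw [← norm_eq_zero, norm_powTensor]; simp
    rw [this, smul_zero]

/-- The one-particle vector. -/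
def oneParticle : h →ₗ[ℂ] Fock h where
  toFun χ := lp.single (E := fun n : ℕ => symPower h n) 2 1 (powTensor χ 1)
  map_add' χ ψ := by
    have : powTensor (χ + ψ) 1 = powTensor χ 1 + powTensor ψ 1 := by
      refine Subtype.ext ?_
      have hu : ∀ a : h, Function.update (fun _ : Fin 1 => (0 : h)) 0 a = fun _ => a := fun a => by
        funext i
        rw [Subsingleton.elim i 0, Function.update_self]
      have := (simpleTensor (h := h) 1).map_update_add (fun _ => 0) 0 χ ψ
      rw [hu, hu, hu] at this
      exact (congrArg _ this).trans (UniformSpace.Completion.coe_add _ _)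
    rw [this]; exact lp.single_add _ _ _ _
  map_smul' c χ := by
    rw [powTensor_smul, pow_one]; exact lp.single_smul _ _ _ _

lemma inner_expVec_oneParticle (φ χ : h) : ⟪expVec φ, oneParticle χ⟫_ℂ = ⟪φ, χ⟫_ℂ := by
  refine (lp.inner_single_right (G := fun n : ℕ => symPower h n) 1 (powTensor χ 1)
    (expVec φ)).trans ?_
  change ⟪level 1 (expVec φ), powTensor χ 1⟫_ℂ = _
  rw [level_expVec, inner_smul_left_symPower, inner_powTensor]
  simp

end FockExp

/-! ### Creation and annihilation operators on exponential vectors -/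

section Ladder
variable {h : Type*} [NormedAddCommGroup h] [InnerProductSpace ℂ h]

lemma inner_consTensor_const (χ φ : h) {n : ℕ} (y : TensorPower h n) :
    ⟪consTensor χ n y, elemTensor (fun _ : Fin (n + 1) => φ)⟫_ℂ
      = ⟪χ, φ⟫_ℂ * ⟪y, elemTensor (fun _ : Fin n => φ)⟫_ℂ := by
  have h1 : elemTensor (fun _ : Fin (n + 1) => φ) = consTensor φ n (elemTensor fun _ => φ) := by
    rw [consTensor_elemTensor]
    congr 1
    funext i
    refine Fin.cases ?_ (fun j => ?_) i <;> simp
  induction y using UniformSpace.Completion.induction_on with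
  | hp => exact isClosed_eq (by fun_prop) (by fun_prop)
  | ih a =>
    induction a using tensor_induction with
    | hs c v =>
      have h2 : consTensor χ n ((c • simpleTensor n v : AlgTensorPower h n) : TensorPower h n)
          = c • elemTensor (Fin.cons χ v : Fin (n + 1) → h) := by
        rw [UniformSpace.Completion.coe_smul, ← consTensor_elemTensor]
        exact map_smul (consTensor χ n) c _
      have h3 : ((c • simpleTensor n v : AlgTensorPower h n) : TensorPower h n)
          = c • elemTensor v := UniformSpace.Completion.coe_smul _ _
      rw [h2, h3]
      refine (inner_smul_left _ _ _).trans ?_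
      refine Eq.trans ?_ (congrArg (⟪χ, φ⟫_ℂ * ·) (inner_smul_left _ _ _).symm)
      rw [inner_elemTensor, inner_elemTensor, Fin.prod_univ_succ]
      simp only [Fin.cons_zero, Fin.cons_succ]
      ring
    | ha x y hx hy =>
      rw [UniformSpace.Completion.coe_add, map_add, inner_add_left, inner_add_left, hx, hy,
        mul_add]

lemma norm_elemTensor_sq {n : ℕ} (φ : Fin n → h) :
    ‖elemTensor φ‖ ^ 2 = ∏ i, ‖φ i‖ ^ 2 := by
  have h1 := inner_elemTensor φ φ
  rw [inner_self_eq_norm_sq_to_K] at h1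
  simp only [inner_self_eq_norm_sq_to_K] at h1
  refine Complex.ofReal_injective ?_
  push_cast
  exact h1

lemma norm_creationLevel_powTensor_sq_le (χ φ : h) (n : ℕ) :
    ‖creationLevel χ n (powTensor φ n)‖ ^ 2 ≤ (n + 1) * (‖χ‖ ^ 2 * (‖φ‖ ^ 2) ^ n) := by
  have h1 : creationLevel χ n (powTensor φ n) = (Real.sqrt (n + 1) : ℂ) •
      (symPower h (n + 1)).orthogonalProjectionOnto
        (elemTensor (Fin.cons χ (fun _ => φ) : Fin (n + 1) → h)) := by
    rw [← consTensor_elemTensor]; rfl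
  have h2 : ‖(symPower h (n + 1)).orthogonalProjectionOnto
        (elemTensor (Fin.cons χ (fun _ => φ) : Fin (n + 1) → h))‖ ^ 2
      ≤ ‖χ‖ ^ 2 * (‖φ‖ ^ 2) ^ n := by
    refine (pow_le_pow_left₀ (norm_nonneg _)
      (Submodule.norm_orthogonalProjectionOnto_apply_le _ _) 2).trans ?_
    rw [norm_elemTensor_sq, Fin.prod_univ_succ]
    simp
  rw [h1, norm_smul, mul_pow, Complex.norm_real, Real.norm_of_nonneg (Real.sqrt_nonneg _),
    Real.sq_sqrt (by positivity)]
  exact mul_le_mul_of_nonneg_left h2 (by positivity)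

/-- Only the crude bound by the norm of the unprojected tensor is needed: the factorials beat the
factor `n + 1`. -/
lemma expVec_mem_creation (χ φ : h) : expVec φ ∈ (creation χ).domain := by
  change Memℓp (creationSeq χ (expVec φ)) 2
  refine memℓp_gen ?_
  simp only [ENNReal.toReal_ofNat, Real.rpow_ofNat]
  rw [← summable_nat_add_iff 1]
  have h1 : ∀ n, ‖creationSeq χ (expVec φ) (n + 1)‖ ^ 2
      ≤ ‖χ‖ ^ 2 * ((2 * ‖φ‖ ^ 2) ^ n / n.factorial) := fun n => by
    have h2 : creationSeq χ (expVec φ) (n + 1)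
        = ((Real.sqrt n.factorial : ℂ))⁻¹ • creationLevel χ n (powTensor φ n) :=
      map_smul (creationLevel χ n) _ _
    have h3 : ((n : ℝ) + 1) ≤ 2 ^ n := by exact_mod_cast Nat.lt_two_pow_self
    rw [h2, norm_smul, mul_pow, norm_inv_sqrt_factorial_sq, inv_mul_eq_div, mul_div_assoc']
    refine div_le_div_of_nonneg_right ((norm_creationLevel_powTensor_sq_le χ φ n).trans ?_)
      (by positivity)
    rw [mul_pow, mul_left_comm]
    gcongr
  exact Summable.of_nonneg_of_le (fun n => by positivity) h1
    ((Real.summable_pow_div_factorial _).mul_left _)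

lemma inner_annihilationLevel_left {χ : h} {n : ℕ} (x : symPower h (n + 1)) (y : symPower h n) :
    ⟪annihilationLevel χ n x, y⟫_ℂ = ⟪x, creationLevel χ n y⟫_ℂ :=
  ContinuousLinearMap.adjoint_inner_left _ _ _

/-- The power of `φ` is already symmetric, so the projection in `creationLevel` drops out of the
pairing. -/
lemma inner_creationLevel_powTensor (χ φ : h) {n : ℕ} (y : symPower h n) :
    ⟪creationLevel χ n y, powTensor φ (n + 1)⟫_ℂ
      = (Real.sqrt (n + 1) : ℂ) * (⟪χ, φ⟫_ℂ * ⟪y, powTensor φ n⟫_ℂ) := by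
  have h1 : creationLevel χ n y = (Real.sqrt (n + 1) : ℂ) •
      (symPower h (n + 1)).orthogonalProjectionOnto (consTensor χ n y) := rfl
  rw [h1, inner_smul_left_symPower, Complex.conj_ofReal,
    Submodule.inner_orthogonalProjectionOnto_eq_of_mem_right]
  exact congrArg _ (inner_consTensor_const χ φ (y : TensorPower h n))

lemma annihilationLevel_powTensor (χ φ : h) (n : ℕ) :
    annihilationLevel χ n (powTensor φ (n + 1))
      = ((Real.sqrt (n + 1) : ℂ) * ⟪χ, φ⟫_ℂ) • powTensor φ n := by
  refine ext_inner_left ℂ fun y => ?_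
  rw [← inner_conj_symm, inner_annihilationLevel_left, inner_conj_symm,
    inner_creationLevel_powTensor, inner_smul_right_symPower, mul_assoc]

/-- Exponential vectors are eigenvectors: the factor `√(n+1)` turns the weight `1/√(n+1)!` into
`1/√n!`. -/
lemma annihilationSeq_expVec (χ φ : h) :
    annihilationSeq χ (expVec φ) = (⟪χ, φ⟫_ℂ • expVec φ : Fock h).1 := by
  funext n
  change annihilationLevel χ n (((Real.sqrt (n + 1).factorial : ℂ))⁻¹ • powTensor φ (n + 1))
    = ⟪χ, φ⟫_ℂ • ((Real.sqrt n.factorial : ℂ))⁻¹ • powTensor φ n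
  rw [map_smul, annihilationLevel_powTensor, smul_smul, smul_smul]
  congr 1
  have h1 : Real.sqrt (n + 1).factorial = Real.sqrt (n + 1) * Real.sqrt n.factorial := by
    rw [Nat.factorial_succ, Nat.cast_mul, Real.sqrt_mul (by positivity)]
    simp
  have h2 : (Real.sqrt (n + 1) : ℂ) ≠ 0 := by
    exact_mod_cast (Real.sqrt_pos.2 (by positivity : (0 : ℝ) < n + 1)).ne'
  rw [h1, Complex.ofReal_mul, mul_inv]
  field_simp

lemma expVec_mem_annihilation (χ φ : h) : expVec φ ∈ (annihilation χ).domain := by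
  change annihilationSeq χ (expVec φ) ∈ lpSubmodule ℂ (fun n : ℕ => symPower h n) 2
  rw [annihilationSeq_expVec]
  exact (⟪χ, φ⟫_ℂ • expVec φ : Fock h).2

lemma annihilation_expVec (χ φ : h) :
    annihilation χ ⟨expVec φ, expVec_mem_annihilation χ φ⟩ = ⟪χ, φ⟫_ℂ • expVec φ :=
  Subtype.ext (annihilationSeq_expVec χ φ)

/-- The operators are adjoint level by level, and on the maximal domains both sides are convergent
sums over the levels. The zero level of a created vector vanishes, which accounts for the index
shift. -/
lemma inner_annihilation_left {χ : h} (x : (annihilation χ).domain) (y : (creation χ).domain) :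
    ⟪annihilation χ x, (y : Fock h)⟫_ℂ = ⟪(x : Fock h), creation χ y⟫_ℂ := by
  have h1 := hasSum_inner_fock (annihilation χ x) (y : Fock h)
  have h2 := hasSum_inner_fock (x : Fock h) (creation χ y)
  have h3 : level 0 (creation χ y) = 0 := rfl
  rw [hasSum_nat_add_iff' 1 |>.symm] at h2
  simp only [Finset.range_one, Finset.sum_singleton, h3, inner_zero_right, sub_zero] at h2
  refine h1.unique (h2.congr_fun fun n => ?_)
  exact inner_annihilationLevel_left (level (n + 1) (x : Fock h)) (level n (y : Fock h))

lemma inner_expVec_creation {χ φ : h} (y : (creation χ).domain) :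
    ⟪expVec φ, creation χ y⟫_ℂ = ⟪φ, χ⟫_ℂ * ⟪expVec φ, (y : Fock h)⟫_ℂ := by
  have h1 := inner_annihilation_left ⟨expVec φ, expVec_mem_annihilation χ φ⟩ y
  rw [annihilation_expVec, inner_smul_left, inner_conj_symm] at h1
  exact h1.symm

/-- The creation operator applied to an exponential vector. -/
def creationExp (χ φ : h) : Fock h := creation χ ⟨expVec φ, expVec_mem_creation χ φ⟩

lemma inner_expVec_creationExp (χ φ ψ : h) :
    ⟪expVec φ, creationExp χ ψ⟫_ℂ = ⟪φ, χ⟫_ℂ * Complex.exp ⟪φ, ψ⟫_ℂ := by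
  rw [creationExp, inner_expVec_creation, inner_expVec]

lemma inner_expVec_annihilation {χ φ : h} (x : (annihilation χ).domain) :
    ⟪expVec φ, annihilation χ x⟫_ℂ = ⟪creationExp χ φ, (x : Fock h)⟫_ℂ := by
  rw [← inner_conj_symm, ← inner_conj_symm (creationExp χ φ)]
  exact congrArg _ (inner_annihilation_left x ⟨expVec φ, expVec_mem_creation χ φ⟩)

end Ladder

/-! ### Exponential vectors and fields on the double Fock space -/

section Double
variable {h : Type*} [NormedAddCommGroup h] [InnerProductSpace ℂ h]

variable (h) in
/-- The bounded bilinear map `(u, v) ↦ u ⊗ v`. -/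
def pureTensorL : Fock h →L[ℂ] Fock h →L[ℂ] DoubleFock h :=
  ((ContinuousLinearMap.compL ℂ (Fock h) (Fock h ⊗[ℂ] Fock h) (DoubleFock h))
    (UniformSpace.Completion.toComplL (𝕜 := ℂ) (E := Fock h ⊗[ℂ] Fock h))).comp
      (TensorProduct.mkL ℂ (Fock h) (Fock h))

lemma pureTensorL_apply (u v : Fock h) : pureTensorL h u v = pureTensor u v := rfl

lemma inner_pureTensor (u v u' v' : Fock h) :
    ⟪pureTensor u v, pureTensor u' v'⟫_ℂ = ⟪u, u'⟫_ℂ * ⟪v, v'⟫_ℂ := by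
  rw [pureTensor, pureTensor, UniformSpace.Completion.inner_coe, TensorProduct.inner_tmul]

/-- The product of two exponential vectors. -/
def expTensor (φ ψ : h) : DoubleFock h := pureTensor (expVec φ) (expVec ψ)

lemma inner_expTensor (φ ψ φ' ψ' : h) :
    ⟪expTensor φ ψ, expTensor φ' ψ'⟫_ℂ = Complex.exp (⟪φ, φ'⟫_ℂ + ⟪ψ, ψ'⟫_ℂ) := by
  rw [expTensor, expTensor, inner_pureTensor, inner_expVec, inner_expVec, Complex.exp_add]

lemma continuous_expTensor : Continuous fun p : h × h => expTensor p.1 p.2 := by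
  change Continuous fun p : h × h => pureTensorL h (expVec p.1) (expVec p.2)
  have h1 : Continuous fun p : h × h => expVec p.1 := continuous_expVec.comp continuous_fst
  have h2 : Continuous fun p : h × h => expVec p.2 := continuous_expVec.comp continuous_snd
  exact ((pureTensorL h).continuous.comp h1).clm_apply h2

lemma eq_zero_of_inner_pureTensor (w : DoubleFock h)
    (hw : ∀ u v, ⟪pureTensor u v, w⟫_ℂ = 0) : w = 0 := by
  refine ext_inner_left ℂ fun y => ?_
  rw [inner_zero_right]
  induction y using UniformSpace.Completion.induction_on with
  | hp => exact isClosed_eq (by fun_prop) (by fun_prop)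
  | ih a =>
    induction a using TensorProduct.induction_on with
    | zero => rw [UniformSpace.Completion.coe_zero, inner_zero_left]
    | tmul u v => exact hw u v
    | add x y hx hy => rw [UniformSpace.Completion.coe_add, inner_add_left, hx, hy, add_zero]

/-- Continuity removes the restriction to `S`. Then totality in a single Fock space is applied to
one factor at a time, through the adjoints of `v ↦ u ⊗ v` and `u ↦ u ⊗ v`. -/
lemma eq_zero_of_inner_expTensor {S : Set (h × h)} (hS : Dense S) (w : DoubleFock h)
    (hw : ∀ p ∈ S, ⟪expTensor p.1 p.2, w⟫_ℂ = 0) : w = 0 := by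
  have h1 : ∀ p : h × h, ⟪expTensor p.1 p.2, w⟫_ℂ = 0 := fun p =>
    hS.induction hw (isClosed_eq (continuous_expTensor.inner continuous_const)
      continuous_const) p
  have h2 : ∀ φ v, ⟪pureTensor (expVec φ) v, w⟫_ℂ = 0 := fun φ v => by
    have h3 : ContinuousLinearMap.adjoint (pureTensorL h (expVec φ)) w = 0 :=
      eq_zero_of_inner_expVec _ fun ψ => by
        rw [ContinuousLinearMap.adjoint_inner_right]; exact h1 (φ, ψ)
    rw [← pureTensorL_apply, ← ContinuousLinearMap.adjoint_inner_right, h3, inner_zero_right]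
  refine eq_zero_of_inner_pureTensor w fun u v => ?_
  have h3 : ContinuousLinearMap.adjoint ((pureTensorL h).flip v) w = 0 :=
    eq_zero_of_inner_expVec _ fun φ => by
      rw [ContinuousLinearMap.adjoint_inner_right]; exact h2 φ v
  have h4 : pureTensor u v = (pureTensorL h).flip v u := rfl
  rw [h4, ← ContinuousLinearMap.adjoint_inner_right, h3, inner_zero_right]

/-- The closure of the graph of `A(φ) ⊗ I + I ⊗ B(J φ)*`. -/
def fieldGraph (J : h → h) (φ : h) : Submodule ℂ (DoubleFock h × DoubleFock h) :=
  (Submodule.span ℂ (Set.range fun p : (annihilation φ).domain × (creation (J φ)).domain =>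
    (pureTensor (p.1 : Fock h) (p.2 : Fock h),
      pureTensor (annihilation φ p.1) (p.2 : Fock h)
        + pureTensor (p.1 : Fock h) (creation (J φ) p.2)))).topologicalClosure

/-- The image of an exponential vector under the field. -/
def fieldExp (J : h → h) (χ φ ψ : h) : DoubleFock h :=
  ⟪χ, φ⟫_ℂ • expTensor φ ψ + pureTensor (expVec φ) (creationExp (J χ) ψ)

/-- The image of an exponential vector under the adjoint field. -/
def fieldAdjExp (J : h → h) (χ φ ψ : h) : DoubleFock h :=
  pureTensor (creationExp χ φ) (expVec ψ) + ⟪J χ, ψ⟫_ℂ • expTensor φ ψ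

lemma expTensor_mem_fieldGraph (J : h → h) (χ φ ψ : h) :
    (expTensor φ ψ, fieldExp J χ φ ψ) ∈ fieldGraph J χ := by
  refine Submodule.le_topologicalClosure _ (Submodule.subset_span
    ⟨(⟨expVec φ, expVec_mem_annihilation χ φ⟩, ⟨expVec ψ, expVec_mem_creation (J χ) ψ⟩), ?_⟩)
  refine Prod.ext rfl ?_
  change pureTensor (annihilation χ ⟨expVec φ, _⟩) (expVec ψ) + _ = _
  rw [annihilation_expVec, fieldExp]
  congr 1
  rw [expTensor, ← pureTensorL_apply, map_smul]
  rfl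

/-- The relation says that exponential vectors lie in the domain of the adjoint of the field. It is
a closed linear condition on `p`, so it passes from the algebraic tensor product to the closure. -/
lemma inner_expTensor_of_mem_fieldGraph {J : h → h} {χ : h} {p : DoubleFock h × DoubleFock h}
    (hp : p ∈ fieldGraph J χ) (φ ψ : h) :
    ⟪expTensor φ ψ, p.2⟫_ℂ = ⟪fieldAdjExp J χ φ ψ, p.1⟫_ℂ := by
  let L : DoubleFock h × DoubleFock h →L[ℂ] ℂ :=
    (innerSL ℂ (expTensor φ ψ)).comp (ContinuousLinearMap.snd ℂ _ _)
      - (innerSL ℂ (fieldAdjExp J χ φ ψ)).comp (ContinuousLinearMap.fst ℂ _ _)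
  have hL : fieldGraph J χ ≤ LinearMap.ker L.toLinearMap := by
    refine Submodule.topologicalClosure_minimal _ ?_ L.isClosed_ker
    rw [Submodule.span_le]
    rintro _ ⟨⟨u, v⟩, rfl⟩
    change ⟪expTensor φ ψ, pureTensor (annihilation χ u) (v : Fock h)
        + pureTensor (u : Fock h) (creation (J χ) v)⟫_ℂ
      - ⟪fieldAdjExp J χ φ ψ, pureTensor (u : Fock h) (v : Fock h)⟫_ℂ = 0
    rw [fieldAdjExp, inner_add_left, inner_add_right, inner_smul_left, expTensor,
      inner_pureTensor, inner_pureTensor, inner_pureTensor, inner_pureTensor,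
      inner_expVec_annihilation, inner_expVec_creation, inner_conj_symm]
    ring
  exact sub_eq_zero.1 (hL hp)

lemma inner_expTensor_fieldExp (J : h → h) (χ φ ψ φ' ψ' : h) :
    ⟪expTensor φ' ψ', fieldExp J χ φ ψ⟫_ℂ
      = (⟪χ, φ⟫_ℂ + ⟪ψ', J χ⟫_ℂ) * ⟪expTensor φ' ψ', expTensor φ ψ⟫_ℂ := by
  rw [fieldExp, inner_add_right, inner_smul_right, expTensor, expTensor, inner_pureTensor,
    inner_pureTensor, inner_expVec_creationExp, inner_expVec, inner_expVec]
  ring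

lemma inner_expTensor_fieldAdjExp (J : h → h) (χ φ ψ φ' ψ' : h) :
    ⟪expTensor φ' ψ', fieldAdjExp J χ φ ψ⟫_ℂ
      = (⟪φ', χ⟫_ℂ + ⟪J χ, ψ⟫_ℂ) * ⟪expTensor φ' ψ', expTensor φ ψ⟫_ℂ := by
  rw [fieldAdjExp, inner_add_right, inner_smul_right, expTensor, expTensor, inner_pureTensor,
    inner_pureTensor, inner_expVec_creationExp, inner_expVec, inner_expVec]
  ring

end Double

/-! ### Uniqueness of Fourier transforms on `ι → ℂ` -/

section Fourier
open MeasureTheory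
variable {ι : Type*} {μ : Measure (ι → ℂ)}

/-- The exponential of a (not necessarily real) linear functional of finitely many coordinates. -/
def expField (s : Finset ι) (c d : ι → ℂ) (ω : ι → ℂ) : ℂ :=
  Complex.exp (∑ i ∈ s, (c i * conj (ω i) + d i * ω i))

@[fun_prop]
lemma measurable_expField (s : Finset ι) (c d : ι → ℂ) : Measurable (expField s c d) := by
  have h1 : ∀ i, Measurable fun ω : ι → ℂ => conj (ω i) := fun i =>
    Complex.continuous_conj.measurable.comp (measurable_pi_apply i)
  unfold expField
  fun_prop

lemma conj_expField (s : Finset ι) (c d : ι → ℂ) (ω : ι → ℂ) :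
    conj (expField s c d ω) = expField s (fun i => conj (d i)) (fun i => conj (c i)) ω := by
  simp only [expField, ← Complex.exp_conj, map_sum, map_add, map_mul, Complex.conj_conj]
  congr 1
  exact Finset.sum_congr rfl fun i _ => add_comm _ _

lemma expField_mul (s : Finset ι) (c d c' d' : ι → ℂ) (ω : ι → ℂ) :
    expField s c d ω * expField s c' d' ω = expField s (c + c') (d + d') ω := by
  simp only [expField, ← Complex.exp_add, ← Finset.sum_add_distrib, Pi.add_apply]
  congr 1
  exact Finset.sum_congr rfl fun i _ => by ring

/-- A real functional sends `x + iy` to `x L(1) + y L(i)`; the coefficients come from writing `x`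
and `y` through `ω` and its conjugate. -/
lemma expField_eq_char (s : Finset ι) (L : ι → ℂ →ₗ[ℝ] ℝ) (ω : ι → ℂ) :
    expField s (fun i => Complex.I * (L i 1 + Complex.I * L i Complex.I) / 2)
        (fun i => Complex.I * (L i 1 - Complex.I * L i Complex.I) / 2) ω
      = Complex.exp (((∑ i ∈ s, L i (ω i) : ℝ) : ℂ) * Complex.I) := by
  rw [expField, Complex.ofReal_sum, Finset.sum_mul]
  congr 1
  refine Finset.sum_congr rfl fun i _ => ?_
  have h1 : L i (ω i) = (ω i).re * L i 1 + (ω i).im * L i Complex.I := by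
    conv_lhs => rw [← Complex.re_add_im (ω i), ← mul_one ((ω i).re : ℂ)]
    rw [map_add, ← Complex.real_smul, ← Complex.real_smul, map_smul, map_smul, smul_eq_mul,
      smul_eq_mul]
  have h2 : conj (ω i) = (ω i).re - (ω i).im * Complex.I := by
    apply Complex.ext <;> simp
  have h3 : ω i = (ω i).re + (ω i).im * Complex.I := (Complex.re_add_im _).symm
  rw [h1, h2]
  generalize (ω i).re = x at *
  generalize (ω i).im = y at *
  rw [h3]
  push_cast
  linear_combination (-((y * L i Complex.I : ℂ) * Complex.I)) * Complex.I_sq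

lemma expField_char_norm (s : Finset ι) (L : ι → ℂ →ₗ[ℝ] ℝ) (ω : ι → ℂ) :
    ‖Complex.exp (((∑ i ∈ s, L i (ω i) : ℝ) : ℂ) * Complex.I)‖ = 1 :=
  Complex.norm_exp_ofReal_mul_I _

lemma measurable_char (s : Finset ι) (L : ι → ℂ →ₗ[ℝ] ℝ) :
    Measurable fun ω : ι → ℂ => Complex.exp (((∑ i ∈ s, L i (ω i) : ℝ) : ℂ) * Complex.I) := by
  simp_rw [← expField_eq_char]
  fun_prop

lemma integrable_char_mul {G : (ι → ℂ) → ℂ} (hG : Integrable G μ) (s : Finset ι)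
    (L : ι → ℂ →ₗ[ℝ] ℝ) :
    Integrable (fun ω => Complex.exp (((∑ i ∈ s, L i (ω i) : ℝ) : ℂ) * Complex.I) * G ω) μ :=
  hG.bdd_mul (measurable_char s L).aestronglyMeasurable
    (Filter.Eventually.of_forall fun ω => (expField_char_norm s L ω).le)

/-- The positive and negative parts of `G` are densities of finite measures whose finite-dimensional
marginals have the same characteristic functions; these marginals determine the measure. -/
lemma withDensity_ofReal_eq_of_integral_char [IsFiniteMeasure μ] {G : (ι → ℂ) → ℝ}
    (hG : Integrable G μ)
    (h0 : ∀ (s : Finset ι) (L : ι → ℂ →ₗ[ℝ] ℝ),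
      ∫ ω, Complex.exp (((∑ i ∈ s, L i (ω i) : ℝ) : ℂ) * Complex.I) * G ω ∂μ = 0) :
    μ.withDensity (fun ω => ENNReal.ofReal (G ω))
      = μ.withDensity (fun ω => ENNReal.ofReal (-G ω)) := by
  classical
  have hf1 := isFiniteMeasure_withDensity_ofReal hG.2
  have hf2 := isFiniteMeasure_withDensity_ofReal (f := fun ω => -G ω) hG.neg.2
  set ν₁ := μ.withDensity (fun ω => ENNReal.ofReal (G ω))
  set ν₂ := μ.withDensity (fun ω => ENNReal.ofReal (-G ω))
  have key : ∀ I : Finset ι, ν₁.map I.restrict = ν₂.map I.restrict := fun I => by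
    refine Measure.ext_of_charFunDual (funext fun L => ?_)
    have hr : Measurable (I.restrict : (ι → ℂ) → (I → ℂ)) := by fun_prop
    let L' : ι → ℂ →ₗ[ℝ] ℝ := fun i =>
      if hi : i ∈ I then L.toLinearMap.comp (LinearMap.single ℝ (fun _ : I => ℂ) ⟨i, hi⟩) else 0
    have hL : ∀ ω : ι → ℂ, L (I.restrict ω) = ∑ i ∈ I, L' i (ω i) := fun ω => by
      have h1 : (I.restrict ω : I → ℂ) = ∑ i : I, Pi.single i (ω i) :=
        (Finset.univ_sum_single (fun i : I => ω i)).symm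
      rw [h1, map_sum, ← Finset.sum_coe_sort I (fun i => L' i (ω i))]
      refine Finset.sum_congr rfl fun i _ => ?_
      simp [L']
    have hc : ∀ ν : Measure (ι → ℂ), charFunDual (ν.map I.restrict) L
        = ∫ ω, Complex.exp (((∑ i ∈ I, L' i (ω i) : ℝ) : ℂ) * Complex.I) ∂ν := fun ν => by
      rw [charFunDual_apply, integral_map hr.aemeasurable
        (by fun_prop)]
      simp_rw [hL]
    have hp : Integrable (fun ω => ((max (G ω) 0 : ℝ) : ℂ)) μ := hG.pos_part.ofReal
    have hn : Integrable (fun ω => ((max (-G ω) 0 : ℝ) : ℂ)) μ := hG.neg_part.ofReal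
    rw [hc, hc, integral_withDensity_eq_integral_toReal_smul₀ (by fun_prop) (by simp),
      integral_withDensity_eq_integral_toReal_smul₀ (by fun_prop) (by simp), ← sub_eq_zero,
      ← h0 I L', ← integral_sub]
    · refine integral_congr_ae (Filter.Eventually.of_forall fun ω => ?_)
      simp only [ENNReal.toReal_ofReal', Complex.real_smul]
      have : (G ω : ℂ) = ((max (G ω) 0 : ℝ) : ℂ) - ((max (-G ω) 0 : ℝ) : ℂ) := by
        rw [← Complex.ofReal_sub, max_zero_sub_max_neg_zero_eq_self]
      rw [this]
      ring
    · refine (integrable_char_mul hp I L').congr (Filter.Eventually.of_forall fun ω => ?_)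
      simp only [ENNReal.toReal_ofReal', Complex.real_smul]
      ring
    · refine (integrable_char_mul hn I L').congr (Filter.Eventually.of_forall fun ω => ?_)
      simp only [ENNReal.toReal_ofReal', Complex.real_smul]
      ring
  have := fun I : Finset ι => (inferInstance : IsFiniteMeasure (ν₂.map I.restrict))
  exact IsProjectiveLimit.unique (P := fun I => ν₂.map I.restrict) key fun I => rfl

lemma ae_eq_zero_of_integral_char_real [IsFiniteMeasure μ] {G : (ι → ℂ) → ℝ}
    (hG : Integrable G μ)
    (h0 : ∀ (s : Finset ι) (L : ι → ℂ →ₗ[ℝ] ℝ),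
      ∫ ω, Complex.exp (((∑ i ∈ s, L i (ω i) : ℝ) : ℂ) * Complex.I) * G ω ∂μ = 0) :
    G =ᵐ[μ] 0 := by
  have h1 := withDensity_ofReal_eq_of_integral_char hG h0
  rw [withDensity_eq_iff_of_sigmaFinite (by fun_prop) (by fun_prop)] at h1
  filter_upwards [h1] with ω hω
  rcases le_total (G ω) 0 with h2 | h2
  · rw [ENNReal.ofReal_of_nonpos h2, eq_comm, ENNReal.ofReal_eq_zero] at hω
    simp only [Pi.zero_apply]; linarith
  · rw [ENNReal.ofReal_of_nonpos (neg_nonpos.2 h2), ENNReal.ofReal_eq_zero] at hω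
    exact le_antisymm hω h2

/-- An integrable function all of whose Fourier coefficients vanish is zero. -/
lemma ae_eq_zero_of_integral_char [IsFiniteMeasure μ] {G : (ι → ℂ) → ℂ}
    (hG : Integrable G μ)
    (h0 : ∀ (s : Finset ι) (L : ι → ℂ →ₗ[ℝ] ℝ),
      ∫ ω, Complex.exp (((∑ i ∈ s, L i (ω i) : ℝ) : ℂ) * Complex.I) * G ω ∂μ = 0) :
    G =ᵐ[μ] 0 := by
  have hconj : Integrable (fun ω => conj (G ω)) μ :=
    Complex.conjCLE.toContinuousLinearMap.integrable_comp hG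
  -- The conjugate of the character of `L` is the character of `-L`, so the hypothesis passes to
  -- `conj G`, and then to the real and imaginary parts.
  have h1 : ∀ (s : Finset ι) (L : ι → ℂ →ₗ[ℝ] ℝ),
      ∫ ω, Complex.exp (((∑ i ∈ s, L i (ω i) : ℝ) : ℂ) * Complex.I) * conj (G ω) ∂μ = 0 :=
    fun s L => by
      have h2 := congrArg conj (h0 s (-L))
      rw [← integral_conj, map_zero] at h2
      rw [← h2]
      refine integral_congr_ae (Filter.Eventually.of_forall fun ω => ?_)
      simp only [map_mul, ← Complex.exp_conj, Complex.conj_ofReal, Complex.conj_I]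
      congr 2
      simp
  have hre : (fun ω => (G ω).re) =ᵐ[μ] 0 := by
    refine ae_eq_zero_of_integral_char_real hG.re fun s L => ?_
    have h2 := integral_add (integrable_char_mul hG s L) (integrable_char_mul hconj s L)
    rw [h0 s L, h1 s L, add_zero] at h2
    rw [← mul_zero (2⁻¹ : ℂ), ← h2, ← integral_const_mul]
    refine integral_congr_ae (Filter.Eventually.of_forall fun ω => ?_)
    simp only [Complex.re_eq_add_conj]
    ring
  have him : (fun ω => (G ω).im) =ᵐ[μ] 0 := by
    refine ae_eq_zero_of_integral_char_real hG.im fun s L => ?_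
    have h2 := integral_sub (integrable_char_mul hG s L) (integrable_char_mul hconj s L)
    rw [h0 s L, h1 s L, sub_zero] at h2
    rw [← mul_zero ((2 * Complex.I)⁻¹ : ℂ), ← h2, ← integral_const_mul]
    refine integral_congr_ae (Filter.Eventually.of_forall fun ω => ?_)
    simp only [Complex.im_eq_sub_conj]
    ring
  filter_upwards [hre, him] with ω h2 h3
  exact Complex.ext h2 h3

end Fourier

/-! ### Complex Gaussian integrals -/

section Gauss
open MeasureTheory ProbabilityTheory

/-- The standard complex Gaussian measure, with `E |w|² = 1`. -/
def complexGaussian : Measure ℂ :=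
  ((gaussianReal 0 (1 / 2)).prod (gaussianReal 0 (1 / 2))).map Complex.measurableEquivRealProd.symm

instance : IsProbabilityMeasure complexGaussian :=
  Measure.isProbabilityMeasure_map (by fun_prop)

/-- The real and imaginary parts are independent of variance `1/2`, and `(c + d)²/4 - (d - c)²/4 = c
d`. -/
lemma integral_exp_complexGaussian (c d : ℂ) :
    ∫ w, Complex.exp (c * conj w + d * w) ∂complexGaussian = Complex.exp (c * d) := by
  rw [complexGaussian, integral_map_equiv]
  have h1 : ∀ p : ℝ × ℝ, Complex.exp (c * conj (Complex.measurableEquivRealProd.symm p)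
        + d * Complex.measurableEquivRealProd.symm p)
      = Complex.exp ((c + d) * p.1) * Complex.exp (Complex.I * (d - c) * p.2) := fun p => by
    have h2 : Complex.measurableEquivRealProd.symm p = p.1 + p.2 * Complex.I := by
      apply Complex.ext <;> simp [Complex.measurableEquivRealProd_symm_apply]
    rw [h2, ← Complex.exp_add]
    congr 1
    simp only [map_add, map_mul, Complex.conj_ofReal, Complex.conj_I]
    ring
  simp_rw [h1]
  rw [integral_prod_mul (fun x : ℝ => Complex.exp ((c + d) * x))
    (fun y : ℝ => Complex.exp (Complex.I * (d - c) * y))]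
  have h2 := complexMGF_id_gaussianReal (μ := 0) (v := 1 / 2) (c + d)
  have h3 := complexMGF_id_gaussianReal (μ := 0) (v := 1 / 2) (Complex.I * (d - c))
  simp only [complexMGF, id] at h2 h3
  rw [h2, h3, ← Complex.exp_add]
  congr 1
  push_cast
  linear_combination ((d - c) ^ 2 / 4) * Complex.I_sq

variable (ι : Type*)

/-- The joint law of independent standard complex Gaussian variables. -/
def gaussField : Measure (ι → ℂ) := Measure.infinitePi fun _ : ι => complexGaussian

instance : IsProbabilityMeasure (gaussField ι) :=
  inferInstanceAs (IsProbabilityMeasure (Measure.infinitePi fun _ : ι => complexGaussian))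

variable {ι}

lemma integral_expField (s : Finset ι) (c d : ι → ℂ) :
    ∫ ω, expField s c d ω ∂gaussField ι = Complex.exp (∑ i ∈ s, c i * d i) := by
  have h1 : ∀ ω : ι → ℂ, expField s c d ω
      = (fun y : s → ℂ => ∏ i : s, Complex.exp (c i * conj (y i) + d i * y i)) (s.restrict ω) :=
    fun ω => by
      simp only [expField, Complex.exp_sum]
      rw [← Finset.prod_coe_sort]
      rfl
  simp_rw [h1]
  rw [gaussField]
  refine (integral_restrict_infinitePi (X := fun _ : ι => ℂ) (μ := fun _ => complexGaussian)
    (s := s) (f := fun y : s → ℂ =>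
      ∏ i : s, Complex.exp (c i * conj (y i) + d i * y i)) ?_).trans ?_
  · refine Continuous.aestronglyMeasurable ?_
    fun_prop
  · rw [integral_fintype_prod_eq_prod
      (fun (i : s) (w : ℂ) => Complex.exp (c i * conj w + d i * w))]
    simp_rw [integral_exp_complexGaussian]
    rw [Complex.exp_sum, ← Finset.prod_coe_sort s fun i => Complex.exp (c i * d i)]

/-- A function that is not integrable has integral `0` by convention, whereas this integral is an
exponential. -/
lemma integrable_expField (s : Finset ι) (c d : ι → ℂ) :
    Integrable (expField s c d) (gaussField ι) := by
  by_contra h1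
  have h2 := integral_expField s c d
  rw [integral_undef h1] at h2
  exact Complex.exp_ne_zero _ h2.symm

lemma memLp_expField (s : Finset ι) (c d : ι → ℂ) :
    MemLp (expField s c d) 2 (gaussField ι) := by
  rw [memLp_two_iff_integrable_sq_norm (measurable_expField s c d).aestronglyMeasurable]
  have h1 : ∀ ω, ‖expField s c d ω‖ ^ 2
      = RCLike.re (expField s (fun i => c i + conj (d i)) (fun i => d i + conj (c i)) ω) :=
    fun ω => by
      have h2 := expField_mul s c d (fun i => conj (d i)) (fun i => conj (c i)) ω
      rw [← conj_expField, Complex.mul_conj] at h2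
      change _ = RCLike.re (expField s (c + fun i => conj (d i)) (d + fun i => conj (c i)) ω)
      rw [← h2, Complex.normSq_eq_norm_sq]
      exact (Complex.ofReal_re _).symm
  simp_rw [h1]
  exact (integrable_expField s _ _).re

end Gauss

/-! ### Unitaries from equal Gram matrices -/

section Unitary
variable {H K I : Type*} [NormedAddCommGroup H] [InnerProductSpace ℂ H]
  [NormedAddCommGroup K] [InnerProductSpace ℂ K]

lemma inner_linearCombination_eq {v : I → H} {w : I → K}
    (hvw : ∀ i j, ⟪v i, v j⟫_ℂ = ⟪w i, w j⟫_ℂ) (x y : I →₀ ℂ) :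
    ⟪Finsupp.linearCombination ℂ v x, Finsupp.linearCombination ℂ v y⟫_ℂ
      = ⟪Finsupp.linearCombination ℂ w x, Finsupp.linearCombination ℂ w y⟫_ℂ := by
  simp only [Finsupp.linearCombination_apply, Finsupp.sum, sum_inner, inner_sum, inner_smul_left,
    inner_smul_right, hvw]

variable [CompleteSpace H]

lemma denseRange_linearCombination {v : I → H} (hv : ∀ x, (∀ i, ⟪v i, x⟫_ℂ = 0) → x = 0) :
    DenseRange (Finsupp.linearCombination ℂ v) := by
  have h1 : (Submodule.span ℂ (Set.range v))ᗮ = ⊥ := by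
    rw [Submodule.eq_bot_iff]
    refine fun x hx => hv x fun i => ?_
    exact hx _ (Submodule.subset_span ⟨i, rfl⟩)
  have h2 := Submodule.dense_iff_topologicalClosure_eq_top.2
    ((Submodule.topologicalClosure_eq_top_iff).2 h1)
  rw [← Finsupp.range_linearCombination] at h2
  exact h2

variable [CompleteSpace K]

lemma exists_isometry_of_gram {v : I → H} {w : I → K}
    (hvw : ∀ i j, ⟪v i, v j⟫_ℂ = ⟪w i, w j⟫_ℂ) (hv : ∀ x, (∀ i, ⟪v i, x⟫_ℂ = 0) → x = 0) :
    ∃ T : H →L[ℂ] K, (∀ i, T (v i) = w i) ∧ ∀ x, ‖T x‖ = ‖x‖ := by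
  have hd := denseRange_linearCombination hv
  have hn : ∀ x, ‖Finsupp.linearCombination ℂ w x‖ = ‖Finsupp.linearCombination ℂ v x‖ :=
    fun x => by
      rw [@norm_eq_sqrt_re_inner ℂ, @norm_eq_sqrt_re_inner ℂ H, inner_linearCombination_eq hvw]
  have hb : ∃ C, ∀ x, ‖Finsupp.linearCombination ℂ w x‖ ≤ C * ‖Finsupp.linearCombination ℂ v x‖ :=
    ⟨1, fun x => by rw [one_mul, hn]⟩
  have he := LinearMap.extendOfNorm_eq (f := Finsupp.linearCombination ℂ w) hd hb
  refine ⟨(Finsupp.linearCombination ℂ w).extendOfNorm (Finsupp.linearCombination ℂ v),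
    fun i => ?_, fun x => ?_⟩
  · have := he (Finsupp.single i 1)
    simpa using this
  · refine hd.induction_on (p := fun x => ‖((Finsupp.linearCombination ℂ w).extendOfNorm
      (Finsupp.linearCombination ℂ v)) x‖ = ‖x‖) x (isClosed_eq (by fun_prop) (by fun_prop)) ?_
    intro a
    rw [he, hn]

/-- Two total families with the same Gram matrix are related by a unitary operator. -/
lemma exists_unitary_of_gram {v : I → H} {w : I → K}
    (hvw : ∀ i j, ⟪v i, v j⟫_ℂ = ⟪w i, w j⟫_ℂ) (hv : ∀ x, (∀ i, ⟪v i, x⟫_ℂ = 0) → x = 0)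
    (hw : ∀ x, (∀ i, ⟪w i, x⟫_ℂ = 0) → x = 0) :
    ∃ U : H ≃ₗᵢ[ℂ] K, ∀ i, U (v i) = w i := by
  obtain ⟨T, hT, hTn⟩ := exists_isometry_of_gram hvw hv
  obtain ⟨S, hS, -⟩ := exists_isometry_of_gram (fun i j => (hvw i j).symm) hw
  have hST : ∀ x, S (T x) = x := fun x => by
    refine (denseRange_linearCombination hv).induction_on (p := fun x => S (T x) = x) x
      (isClosed_eq (by fun_prop) (by fun_prop)) fun a => ?_
    simp only [Finsupp.linearCombination_apply, Finsupp.sum, map_sum, map_smul, hT, hS]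
  have hTS : ∀ x, T (S x) = x := fun x => by
    refine (denseRange_linearCombination hw).induction_on (p := fun x => T (S x) = x) x
      (isClosed_eq (by fun_prop) (by fun_prop)) fun a => ?_
    simp only [Finsupp.linearCombination_apply, Finsupp.sum, map_sum, map_smul, hT, hS]
  exact ⟨⟨LinearEquiv.ofLinearMap T.toLinearMap S.toLinearMap (LinearMap.ext hTS)
    (LinearMap.ext hST), hTn⟩, hT⟩

end Unitary

/-! ### Wick exponentials in the Gaussian `L²` space -/

section Wick
open MeasureTheory
variable {h ι : Type*} [NormedAddCommGroup h] [InnerProductSpace ℂ h]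
  (b : HilbertBasis ι ℂ h)

lemma inner_linearCombination_hilbertBasis (c d : ι →₀ ℂ) {s : Finset ι} (hs : c.support ⊆ s) :
    ⟪Finsupp.linearCombination ℂ b c, Finsupp.linearCombination ℂ b d⟫_ℂ
      = ∑ i ∈ s, conj (c i) * d i := by
  rw [b.orthonormal.inner_finsupp_eq_sum_left, Finsupp.sum_of_support_subset _ hs _ (by simp)]

lemma expField_of_support_subset {c d : ι → ℂ} {s t : Finset ι} (hst : s ⊆ t)
    (hc : ∀ i, i ∉ s → c i = 0) (hd : ∀ i, i ∉ s → d i = 0) (ω : ι → ℂ) :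
    expField s c d ω = expField t c d ω := by
  unfold expField
  congr 1
  refine Finset.sum_subset hst fun i _ hi => ?_
  rw [hc i hi, hd i hi, zero_mul, zero_mul, add_zero]

/-- The Wick exponential `exp (conj z(φ) + z(η) - ⟪η, φ⟫)`, where `φ` and `η` have the coordinates
`p.1` and `p.2` and where the Gaussian field `z` is antilinear. -/
def wickFun (p : (ι →₀ ℂ) × (ι →₀ ℂ)) (ω : ι → ℂ) : ℂ :=
  open Classical in
  Complex.exp (-⟪Finsupp.linearCombination ℂ b p.2, Finsupp.linearCombination ℂ b p.1⟫_ℂ)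
    * expField (p.1.support ∪ p.2.support) p.1 (fun i => conj (p.2 i)) ω

lemma wickFun_eq [DecidableEq ι] (p : (ι →₀ ℂ) × (ι →₀ ℂ)) {s : Finset ι}
    (hs : p.1.support ∪ p.2.support ⊆ s) (ω : ι → ℂ) :
    wickFun b p ω = Complex.exp (-∑ i ∈ s, conj (p.2 i) * p.1 i)
      * expField s p.1 (fun i => conj (p.2 i)) ω := by
  rw [wickFun, inner_linearCombination_hilbertBasis b p.2 p.1
    (Finset.subset_union_right.trans hs)]
  congr 1
  convert expField_of_support_subset hs _ _ ω
  · intro i hi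
    simp only [Finset.mem_union, Finsupp.mem_support_iff, not_or, not_not] at hi
    exact hi.1
  · intro i hi
    simp only [Finset.mem_union, Finsupp.mem_support_iff, not_or, not_not] at hi
    simp [hi.2]

lemma memLp_wickFun (p : (ι →₀ ℂ) × (ι →₀ ℂ)) : MemLp (wickFun b p) 2 (gaussField ι) :=
  (memLp_expField _ _ _).const_mul _

lemma integral_wickFun (p : (ι →₀ ℂ) × (ι →₀ ℂ)) : ∫ ω, wickFun b p ω ∂gaussField ι = 1 := by
  classical
  simp_rw [wickFun_eq b p (Finset.Subset.refl _)]
  rw [integral_const_mul, integral_expField, ← Complex.exp_add, ← Complex.exp_zero]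
  congr 1
  rw [neg_add_eq_zero]
  exact Finset.sum_congr rfl fun i _ => mul_comm _ _

/-- A product of two Wick exponentials is a constant times a third one, whose mean is `1`. So the
constant is the inner product, and integrals against two exponentials reduce to integrals against
one. -/
lemma conj_wickFun_mul (p q : (ι →₀ ℂ) × (ι →₀ ℂ)) (ω : ι → ℂ) :
    conj (wickFun b q ω) * wickFun b p ω
      = Complex.exp (⟪Finsupp.linearCombination ℂ b q.1, Finsupp.linearCombination ℂ b p.1⟫_ℂ
          + ⟪Finsupp.linearCombination ℂ b p.2, Finsupp.linearCombination ℂ b q.2⟫_ℂ)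
        * conj (wickFun b (q.1 + p.2, q.2 + p.1) ω) := by
  classical
  set s := (q.1.support ∪ p.2.support) ∪ (q.2.support ∪ p.1.support)
  have hq : q.1.support ∪ q.2.support ⊆ s := by
    intro i; simp only [s, Finset.mem_union]; tauto
  have hp : p.1.support ∪ p.2.support ⊆ s := by
    intro i; simp only [s, Finset.mem_union]; tauto
  have hqp : (q.1 + p.2).support ∪ (q.2 + p.1).support ⊆ s :=
    Finset.union_subset_union Finsupp.support_add Finsupp.support_add
  rw [wickFun_eq b p hp, wickFun_eq b q hq, wickFun_eq b _ hqp,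
    inner_linearCombination_hilbertBasis b q.1 p.1 (Finset.subset_union_left.trans hq),
    inner_linearCombination_hilbertBasis b p.2 q.2 (Finset.subset_union_right.trans hp)]
  simp only [expField, map_mul, ← Complex.exp_conj, ← Complex.exp_add, map_sum, map_neg,
    Complex.conj_conj, map_add, ← Finset.sum_neg_distrib, ← Finset.sum_add_distrib,
    Finsupp.add_apply]
  congr 1
  exact Finset.sum_congr rfl fun i _ => by ring

/-- The Wick exponentials as square integrable functions. -/
def wickLp (p : (ι →₀ ℂ) × (ι →₀ ℂ)) : Lp ℂ 2 (gaussField ι) := (memLp_wickFun b p).toLp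

lemma coeFn_wickLp (p : (ι →₀ ℂ) × (ι →₀ ℂ)) : wickLp b p =ᵐ[gaussField ι] wickFun b p :=
  MemLp.coeFn_toLp _

lemma inner_wickLp_left (p : (ι →₀ ℂ) × (ι →₀ ℂ)) (f : Lp ℂ 2 (gaussField ι)) :
    ⟪wickLp b p, f⟫_ℂ = ∫ ω, conj (wickFun b p ω) * f ω ∂gaussField ι := by
  rw [L2.inner_def]
  refine integral_congr_ae ?_
  filter_upwards [coeFn_wickLp b p] with ω hω
  rw [hω, RCLike.inner_apply, mul_comm]

lemma inner_wickLp (p q : (ι →₀ ℂ) × (ι →₀ ℂ)) :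
    ⟪wickLp b q, wickLp b p⟫_ℂ
      = Complex.exp (⟪Finsupp.linearCombination ℂ b q.1, Finsupp.linearCombination ℂ b p.1⟫_ℂ
          + ⟪Finsupp.linearCombination ℂ b p.2, Finsupp.linearCombination ℂ b q.2⟫_ℂ) := by
  have h1 : ⟪wickLp b q, wickLp b p⟫_ℂ
      = ∫ ω, conj (wickFun b q ω) * wickFun b p ω ∂gaussField ι := by
    rw [inner_wickLp_left]
    refine integral_congr_ae ?_
    filter_upwards [coeFn_wickLp b p] with ω hω
    rw [hω]
  rw [h1]
  simp_rw [conj_wickFun_mul]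
  rw [integral_const_mul, integral_conj, integral_wickFun, map_one, mul_one]

lemma conj_wickFun_mul' (p q : (ι →₀ ℂ) × (ι →₀ ℂ)) (ω : ι → ℂ) :
    conj (wickFun b q ω) * wickFun b p ω
      = ⟪wickLp b q, wickLp b p⟫_ℂ * conj (wickFun b (q.1 + p.2, q.2 + p.1) ω) := by
  rw [conj_wickFun_mul, inner_wickLp]

/-- An integrable function orthogonal to all the Wick exponentials vanishes. -/
lemma ae_eq_zero_of_integral_wickFun {G : (ι → ℂ) → ℂ} (hG : Integrable G (gaussField ι))
    (h0 : ∀ p, ∫ ω, conj (wickFun b p ω) * G ω ∂gaussField ι = 0) : G =ᵐ[gaussField ι] 0 := by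
  classical
  refine ae_eq_zero_of_integral_char hG fun s L => ?_
  set C : ι → ℂ := fun i => Complex.I * (L i 1 + Complex.I * L i Complex.I) / 2
  set D : ι → ℂ := fun i => Complex.I * (L i 1 - Complex.I * L i Complex.I) / 2
  -- With these parameters the conjugate of the Wick exponential is a nonzero multiple of the
  -- character of `L`.
  set c : ι →₀ ℂ := Finsupp.onFinset s (fun i => if i ∈ s then conj (D i) else 0) (by simp_all)
  set d : ι →₀ ℂ := Finsupp.onFinset s (fun i => if i ∈ s then C i else 0) (by simp_all)
  have hs : c.support ∪ d.support ⊆ s :=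
    Finset.union_subset Finsupp.support_onFinset_subset Finsupp.support_onFinset_subset
  have h1 := h0 (c, d)
  simp_rw [wickFun_eq b (c, d) hs, map_mul, conj_expField, mul_assoc] at h1
  rw [integral_const_mul, ← Complex.exp_conj] at h1
  have h2 := (mul_eq_zero.1 h1).resolve_left (Complex.exp_ne_zero _)
  rw [← h2]
  refine integral_congr_ae (Filter.Eventually.of_forall fun ω => ?_)
  simp only [← expField_eq_char]
  congr 1
  unfold expField
  congr 1
  refine Finset.sum_congr rfl fun i hi => ?_
  have hc : conj (c i) = D i := by
    simp only [c, Finsupp.onFinset_apply, if_pos hi, Complex.conj_conj]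
  have hd : conj (conj (d i)) = C i := by
    simp only [d, Finsupp.onFinset_apply, if_pos hi, Complex.conj_conj]
  beta_reduce
  rw [hc, hd]

lemma eq_zero_of_inner_wickLp (f : Lp ℂ 2 (gaussField ι)) (hf : ∀ p, ⟪wickLp b p, f⟫_ℂ = 0) :
    f = 0 := by
  have h1 := ae_eq_zero_of_integral_wickFun b
    (memLp_one_iff_integrable.1 ((Lp.memLp f).mono_exponent (by norm_num)))
    fun p => by rw [← inner_wickLp_left, hf]
  exact (Lp.eq_zero_iff_ae_eq_zero).2 h1

end Wick

/-! ### The fields as maximal multiplication operators -/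

section Model
open MeasureTheory
variable {h ι : Type*} [NormedAddCommGroup h] [InnerProductSpace ℂ h]

lemma norm_conjugation {J : h →ₗ⋆[ℂ] h} (hJi : ∀ φ ψ, ⟪J φ, J ψ⟫_ℂ = ⟪ψ, φ⟫_ℂ) (φ : h) :
    ‖J φ‖ = ‖φ‖ := by
  rw [@norm_eq_sqrt_re_inner ℂ, @norm_eq_sqrt_re_inner ℂ h, hJi]

lemma continuous_conjugation {J : h →ₗ⋆[ℂ] h} (hJi : ∀ φ ψ, ⟪J φ, J ψ⟫_ℂ = ⟪ψ, φ⟫_ℂ) :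
    Continuous J :=
  AddMonoidHomClass.continuous_of_bound J 1 fun φ => by rw [norm_conjugation hJi, one_mul]

variable (b : HilbertBasis ι ℂ h) (J : h →ₗ⋆[ℂ] h)

/-- The exponential vectors of the double Fock space that correspond to the Wick exponentials. -/
def wickTensor (p : (ι →₀ ℂ) × (ι →₀ ℂ)) : DoubleFock h :=
  expTensor (Finsupp.linearCombination ℂ b p.1) (J (Finsupp.linearCombination ℂ b p.2))

variable {J}

lemma inner_wickTensor (hJi : ∀ φ ψ, ⟪J φ, J ψ⟫_ℂ = ⟪ψ, φ⟫_ℂ) (p q : (ι →₀ ℂ) × (ι →₀ ℂ)) :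
    ⟪wickTensor b J q, wickTensor b J p⟫_ℂ = ⟪wickLp b q, wickLp b p⟫_ℂ := by
  rw [wickTensor, wickTensor, inner_expTensor, inner_wickLp, hJi]

lemma eq_zero_of_inner_wickTensor (hJ : ∀ φ, J (J φ) = φ)
    (hJi : ∀ φ ψ, ⟪J φ, J ψ⟫_ℂ = ⟪ψ, φ⟫_ℂ) (w : DoubleFock h)
    (hw : ∀ p, ⟪wickTensor b J p, w⟫_ℂ = 0) : w = 0 := by
  have h1 : DenseRange (Finsupp.linearCombination ℂ b) := by
    have h2 := Submodule.dense_iff_topologicalClosure_eq_top.2 b.dense_span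
    rw [← Finsupp.range_linearCombination] at h2
    exact h2
  have h2 : DenseRange (J ∘ Finsupp.linearCombination ℂ b) :=
    (Function.Surjective.denseRange fun φ => ⟨J φ, hJ φ⟩).comp h1 (continuous_conjugation hJi)
  refine eq_zero_of_inner_expTensor (h1.prodMap h2) w ?_
  rintro _ ⟨p, rfl⟩
  exact hw p

lemma exists_wick_unitary (hJ : ∀ φ, J (J φ) = φ) (hJi : ∀ φ ψ, ⟪J φ, J ψ⟫_ℂ = ⟪ψ, φ⟫_ℂ) :
    ∃ U : Lp ℂ 2 (gaussField ι) ≃ₗᵢ[ℂ] DoubleFock h, ∀ p, U (wickLp b p) = wickTensor b J p :=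
  exists_unitary_of_gram (fun p q => (inner_wickTensor b hJi q p).symm)
    (eq_zero_of_inner_wickLp b) (eq_zero_of_inner_wickTensor b hJ hJi)

lemma integrable_conj_mul {Ω : Type*} [MeasurableSpace Ω] {μ : Measure Ω} {f g : Ω → ℂ}
    (hf : MemLp f 2 μ) (hg : MemLp g 2 μ) : Integrable (fun ω => conj (f ω) * g ω) μ :=
  MemLp.integrable_mul (p := 2) (q := 2) hf.star hg

lemma integrable_mul_of_memLp_two {Ω : Type*} [MeasurableSpace Ω] {μ : Measure Ω} {f g : Ω → ℂ}
    (hf : MemLp f 2 μ) (hg : MemLp g 2 μ) : Integrable (fun ω => f ω * g ω) μ :=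
  MemLp.integrable_mul (p := 2) (q := 2) hf hg

lemma integrable_of_memLp_two {Ω : Type*} [MeasurableSpace Ω] {μ : Measure Ω} [IsFiniteMeasure μ]
    {f : Ω → ℂ} (hf : MemLp f 2 μ) : Integrable f μ :=
  memLp_one_iff_integrable.1 (hf.mono_exponent (by norm_num))

variable (J) in
/-- The Gaussian field, as a square integrable function: the image of `Ω ⊗ J χ`. -/
def gaussZ (U : Lp ℂ 2 (gaussField ι) ≃ₗᵢ[ℂ] DoubleFock h) :
    h →ₗ⋆[ℂ] Lp ℂ 2 (gaussField ι) :=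
  ((U.symm.toLinearEquiv.toLinearMap.comp (pureTensorL h (vacuum h)).toLinearMap).comp
    oneParticle).comp J

section
variable {b} {U : Lp ℂ 2 (gaussField ι) ≃ₗᵢ[ℂ] DoubleFock h}

lemma inner_wickLp_symm (hU : ∀ p, U (wickLp b p) = wickTensor b J p)
    (p : (ι →₀ ℂ) × (ι →₀ ℂ)) (x : DoubleFock h) :
    ⟪wickLp b p, U.symm x⟫_ℂ = ⟪wickTensor b J p, x⟫_ℂ := by
  rw [← hU, ← U.inner_map_map, U.apply_symm_apply]

lemma inner_wickLp_gaussZ (hJi : ∀ φ ψ, ⟪J φ, J ψ⟫_ℂ = ⟪ψ, φ⟫_ℂ)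
    (hU : ∀ p, U (wickLp b p) = wickTensor b J p) (p : (ι →₀ ℂ) × (ι →₀ ℂ)) (χ : h) :
    ⟪wickLp b p, gaussZ J U χ⟫_ℂ = ⟪χ, Finsupp.linearCombination ℂ b p.2⟫_ℂ := by
  refine (inner_wickLp_symm hU p (pureTensor (vacuum h) (oneParticle (J χ)))).trans ?_
  rw [wickTensor, expTensor, inner_pureTensor, ← expVec_zero, inner_expVec,
    inner_expVec_oneParticle, hJi]
  simp

lemma integral_conj_wickFun_mul_gaussZ (hJi : ∀ φ ψ, ⟪J φ, J ψ⟫_ℂ = ⟪ψ, φ⟫_ℂ)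
    (hU : ∀ p, U (wickLp b p) = wickTensor b J p) (p q : (ι →₀ ℂ) × (ι →₀ ℂ)) (χ : h) :
    ∫ ω, conj (wickFun b q ω) * wickFun b p ω * gaussZ J U χ ω ∂gaussField ι
      = ⟪wickLp b q, wickLp b p⟫_ℂ * (⟪χ, Finsupp.linearCombination ℂ b q.2⟫_ℂ
          + ⟪χ, Finsupp.linearCombination ℂ b p.1⟫_ℂ) := by
  simp_rw [conj_wickFun_mul', mul_assoc]
  rw [integral_const_mul, ← inner_wickLp_left, inner_wickLp_gaussZ hJi hU]
  simp only [map_add, inner_add_right]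

lemma integrable_conj_wickFun_mul_mul (p q : (ι →₀ ℂ) × (ι →₀ ℂ))
    (f : Lp ℂ 2 (gaussField ι)) :
    Integrable (fun ω => conj (wickFun b q ω) * wickFun b p ω * f ω) (gaussField ι) := by
  simp_rw [conj_wickFun_mul', mul_assoc]
  exact (integrable_conj_mul (memLp_wickFun b _) (Lp.memLp f)).const_mul _

/-- Both sides have the same integrals against all Wick exponentials. The product on the left is a
priori only integrable, which is why totality is needed for integrable functions and not just in
`L²`. -/
lemma gaussZ_mul_wickFun (hJi : ∀ φ ψ, ⟪J φ, J ψ⟫_ℂ = ⟪ψ, φ⟫_ℂ)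
    (hU : ∀ p, U (wickLp b p) = wickTensor b J p) (p : (ι →₀ ℂ) × (ι →₀ ℂ)) (χ : h) :
    ∀ᵐ ω ∂gaussField ι, gaussZ J U χ ω * wickFun b p ω
      = U.symm (fieldExp J χ (Finsupp.linearCombination ℂ b p.1)
          (J (Finsupp.linearCombination ℂ b p.2))) ω := by
  set v := fieldExp J χ (Finsupp.linearCombination ℂ b p.1)
          (J (Finsupp.linearCombination ℂ b p.2))
  have h1 := ae_eq_zero_of_integral_wickFun b
    (G := fun ω => gaussZ J U χ ω * wickFun b p ω - U.symm v ω)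
    ((integrable_mul_of_memLp_two (Lp.memLp _) (memLp_wickFun b p)).sub
      (integrable_of_memLp_two (Lp.memLp _))) fun q => by
      have h2 : ∀ ω, conj (wickFun b q ω) * (gaussZ J U χ ω * wickFun b p ω - U.symm v ω)
          = conj (wickFun b q ω) * wickFun b p ω * gaussZ J U χ ω
            - conj (wickFun b q ω) * U.symm v ω := fun ω => by ring
      simp_rw [h2]
      rw [integral_sub (integrable_conj_wickFun_mul_mul p q _)
        (integrable_conj_mul (memLp_wickFun b _) (Lp.memLp _)),
        integral_conj_wickFun_mul_gaussZ hJi hU, ← inner_wickLp_left, inner_wickLp_symm hU,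
        wickTensor, inner_expTensor_fieldExp, hJi, ← inner_wickTensor b hJi, wickTensor,
        wickTensor]
      ring
  filter_upwards [h1] with ω hω
  exact sub_eq_zero.1 hω

/-- The matrix elements of the conjugate field are the conjugates of those of the field with `p` and
`q` exchanged. -/
lemma conj_gaussZ_mul_wickFun (hJi : ∀ φ ψ, ⟪J φ, J ψ⟫_ℂ = ⟪ψ, φ⟫_ℂ)
    (hU : ∀ p, U (wickLp b p) = wickTensor b J p) (p : (ι →₀ ℂ) × (ι →₀ ℂ)) (χ : h) :
    ∀ᵐ ω ∂gaussField ι, conj (gaussZ J U χ ω) * wickFun b p ω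
      = U.symm (fieldAdjExp J χ (Finsupp.linearCombination ℂ b p.1)
          (J (Finsupp.linearCombination ℂ b p.2))) ω := by
  set v := fieldAdjExp J χ (Finsupp.linearCombination ℂ b p.1)
          (J (Finsupp.linearCombination ℂ b p.2))
  have h1 := ae_eq_zero_of_integral_wickFun b
    (G := fun ω => conj (gaussZ J U χ ω) * wickFun b p ω - U.symm v ω)
    ((integrable_conj_mul (Lp.memLp _) (memLp_wickFun b p)).sub
      (integrable_of_memLp_two (Lp.memLp _))) fun q => by
      have h2 : ∀ ω, conj (wickFun b q ω) * (conj (gaussZ J U χ ω) * wickFun b p ω - U.symm v ω)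
          = conj (conj (wickFun b p ω) * wickFun b q ω * gaussZ J U χ ω)
            - conj (wickFun b q ω) * U.symm v ω := fun ω => by
        simp only [map_mul, Complex.conj_conj]; ring
      have h3 : Integrable (fun ω => conj (conj (wickFun b p ω) * wickFun b q ω
          * gaussZ J U χ ω)) (gaussField ι) :=
        Complex.conjCLE.toContinuousLinearMap.integrable_comp
          (integrable_conj_wickFun_mul_mul q p _)
      simp_rw [h2]
      rw [integral_sub h3 (integrable_conj_mul (memLp_wickFun b _) (Lp.memLp _)), integral_conj,
        integral_conj_wickFun_mul_gaussZ hJi hU, ← inner_wickLp_left, inner_wickLp_symm hU,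
        wickTensor, inner_expTensor_fieldAdjExp, hJi, map_mul, map_add, inner_conj_symm,
        inner_conj_symm, inner_conj_symm, ← inner_wickTensor b hJi, wickTensor, wickTensor]
      ring
  filter_upwards [h1] with ω hω
  exact sub_eq_zero.1 hω

/-- The adjoint relation moves the field onto a Wick exponential, where it acts as multiplication by
the conjugate of the Gaussian field. -/
lemma ae_eq_of_mem_fieldGraph (hJi : ∀ φ ψ, ⟪J φ, J ψ⟫_ℂ = ⟪ψ, φ⟫_ℂ)
    (hU : ∀ p, U (wickLp b p) = wickTensor b J p) {χ : h} {x y : Lp ℂ 2 (gaussField ι)}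
    (hxy : (U x, U y) ∈ fieldGraph J χ) :
    ∀ᵐ ω ∂gaussField ι, y ω = gaussZ J U χ ω * x ω := by
  have h1 := ae_eq_zero_of_integral_wickFun b (G := fun ω => y ω - gaussZ J U χ ω * x ω)
    ((integrable_of_memLp_two (Lp.memLp _)).sub
      (integrable_mul_of_memLp_two (Lp.memLp _) (Lp.memLp _))) fun p => by
      set v := fieldAdjExp J χ (Finsupp.linearCombination ℂ b p.1)
          (J (Finsupp.linearCombination ℂ b p.2)) with hv
      have h2 : ∀ᵐ ω ∂gaussField ι, conj (wickFun b p ω) * (y ω - gaussZ J U χ ω * x ω)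
          = conj (wickFun b p ω) * y ω - conj (U.symm v ω) * x ω := by
        filter_upwards [conj_gaussZ_mul_wickFun hJi hU p χ] with ω hω
        rw [← hω, map_mul, Complex.conj_conj]
        ring
      have h3 : ⟪U.symm v, x⟫_ℂ = ∫ ω, conj (U.symm v ω) * x ω ∂gaussField ι := by
        rw [L2.inner_def]
        simp_rw [RCLike.inner_apply, mul_comm]
      rw [integral_congr_ae h2, integral_sub (integrable_conj_mul (memLp_wickFun b _) (Lp.memLp _))
        (integrable_conj_mul (Lp.memLp _) (Lp.memLp _)), ← inner_wickLp_left, ← h3, sub_eq_zero,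
        ← U.inner_map_map, ← U.inner_map_map (U.symm v), hU, U.apply_symm_apply]
      exact inner_expTensor_of_mem_fieldGraph hxy _ _
  filter_upwards [h1] with ω hω
  exact sub_eq_zero.1 hω

/-- The component `w` of `(x, y)` orthogonal to the field graph still satisfies `w₂ = z w₁`.
Orthogonality to the Wick exponentials gives `w₁ + conj z w₂ = 0`, whence `(1 + |z|²) w₁ = 0` and `w
= 0`. -/
lemma mem_fieldGraph_of_ae_eq (hJi : ∀ φ ψ, ⟪J φ, J ψ⟫_ℂ = ⟪ψ, φ⟫_ℂ)
    (hU : ∀ p, U (wickLp b p) = wickTensor b J p) {χ : h} {x y : Lp ℂ 2 (gaussField ι)}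
    (hxy : ∀ᵐ ω ∂gaussField ι, y ω = gaussZ J U χ ω * x ω) :
    (U x, U y) ∈ fieldGraph J χ := by
  -- The plain product carries the sup norm; orthogonal decomposition needs the Hilbert sum.
  let T : WithLp 2 (Lp ℂ 2 (gaussField ι) × Lp ℂ 2 (gaussField ι)) →L[ℂ]
      DoubleFock h × DoubleFock h :=
    ((U.toContinuousLinearEquiv : Lp ℂ 2 (gaussField ι) →L[ℂ] DoubleFock h).prodMap
      (U.toContinuousLinearEquiv : Lp ℂ 2 (gaussField ι) →L[ℂ] DoubleFock h)).comp
      (WithLp.prodContinuousLinearEquiv 2 ℂ (Lp ℂ 2 (gaussField ι))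
        (Lp ℂ 2 (gaussField ι))).toContinuousLinearMap
  let K : Submodule ℂ (WithLp 2 (Lp ℂ 2 (gaussField ι) × Lp ℂ 2 (gaussField ι))) :=
    (fieldGraph J χ).comap T.toLinearMap
  have hK : IsClosed (K : Set (WithLp 2 (Lp ℂ 2 (gaussField ι) × Lp ℂ 2 (gaussField ι)))) :=
    (Submodule.isClosed_topologicalClosure _).preimage T.continuous
  have : CompleteSpace K := hK.completeSpace_coe
  obtain ⟨k, hk, w, hw, hkw⟩ := K.exists_add_mem_mem_orthogonal (WithLp.toLp 2 (x, y))
  have hk' : (U k.fst, U k.snd) ∈ fieldGraph J χ := hk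
  have hx : x = k.fst + w.fst := congrArg (fun v => v.fst) hkw
  have hy : y = k.snd + w.snd := congrArg (fun v => v.snd) hkw
  have hw2 : ∀ᵐ ω ∂gaussField ι, w.snd ω = gaussZ J U χ ω * w.fst ω := by
    have hx' := Lp.coeFn_add k.fst w.fst
    have hy' := Lp.coeFn_add k.snd w.snd
    rw [← hx] at hx'
    rw [← hy] at hy'
    filter_upwards [ae_eq_of_mem_fieldGraph hJi hU hk', hxy, hx', hy'] with ω h1 h2 h3 h4
    rw [h3, h4, Pi.add_apply, Pi.add_apply, h1, mul_add] at h2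
    exact add_left_cancel h2
  have hw1 := ae_eq_zero_of_integral_wickFun b
    (G := fun ω => w.fst ω + conj (gaussZ J U χ ω) * w.snd ω)
    ((integrable_of_memLp_two (Lp.memLp _)).add
      (integrable_conj_mul (Lp.memLp _) (Lp.memLp _))) fun p => by
      set v := fieldExp J χ (Finsupp.linearCombination ℂ b p.1)
          (J (Finsupp.linearCombination ℂ b p.2)) with hv
      have hp : WithLp.toLp 2 (wickLp b p, U.symm v) ∈ K := by
        change (U (wickLp b p), U (U.symm v)) ∈ fieldGraph J χ
        rw [hU, U.apply_symm_apply]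
        exact expTensor_mem_fieldGraph J χ _ _
      have h1 := hw _ hp
      rw [WithLp.prod_inner_apply] at h1
      change ⟪wickLp b p, w.fst⟫_ℂ + ⟪U.symm v, w.snd⟫_ℂ = 0 at h1
      have h3 : ⟪U.symm v, w.snd⟫_ℂ = ∫ ω, conj (U.symm v ω) * w.snd ω ∂gaussField ι := by
        rw [L2.inner_def]
        simp_rw [RCLike.inner_apply, mul_comm]
      rw [inner_wickLp_left, h3, ← integral_add (integrable_conj_mul (memLp_wickFun b _)
        (Lp.memLp _)) (integrable_conj_mul (Lp.memLp _) (Lp.memLp _))] at h1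
      rw [← h1]
      refine integral_congr_ae ?_
      filter_upwards [gaussZ_mul_wickFun hJi hU p χ] with ω hω
      rw [← hω, map_mul]
      ring
  have hw0 : w.fst = 0 := by
    refine (Lp.eq_zero_iff_ae_eq_zero).2 ?_
    filter_upwards [hw1, hw2] with ω h1 h2
    rw [h2, ← mul_assoc, mul_comm (conj _), Complex.mul_conj] at h1
    have h3 : (1 + (Complex.normSq (gaussZ J U χ ω) : ℂ)) * w.fst ω = 0 := by
      rw [add_mul, one_mul]; exact h1
    refine (mul_eq_zero.1 h3).resolve_left ?_
    have h4 : (0 : ℝ) < 1 + Complex.normSq (gaussZ J U χ ω) := by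
      have := Complex.normSq_nonneg (gaussZ J U χ ω)
      positivity
    exact_mod_cast h4.ne'
  have hw0' : w.snd = 0 := by
    refine (Lp.eq_zero_iff_ae_eq_zero).2 ?_
    have h1 := (Lp.eq_zero_iff_ae_eq_zero).1 hw0
    filter_upwards [h1, hw2] with ω h1 h2
    rw [h2, h1, Pi.zero_apply, mul_zero]
  rw [hx, hy, hw0, hw0', add_zero, add_zero]
  exact hk'

end

/-- In the Gaussian representation the fields are the maximal multiplication operators. -/
theorem exists_gaussian_representation [CompleteSpace h] (hJ : ∀ φ, J (J φ) = φ)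
    (hJi : ∀ φ ψ, ⟪J φ, J ψ⟫_ℂ = ⟪ψ, φ⟫_ℂ) :
    ∃ (s : Set h) (U : Lp ℂ 2 (gaussField s) ≃ₗᵢ[ℂ] DoubleFock h)
      (z : h →ₗ⋆[ℂ] Lp ℂ 2 (gaussField s)), ∀ χ x y,
        (U x, U y) ∈ fieldGraph J χ ↔ ∀ᵐ ω ∂gaussField s, y ω = z χ ω * x ω := by
  obtain ⟨w, b, -⟩ := exists_hilbertBasis ℂ h
  obtain ⟨U, hU⟩ := exists_wick_unitary b hJ hJi
  exact ⟨w, U, gaussZ J U, fun χ x y =>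
    ⟨ae_eq_of_mem_fieldGraph hJi hU, mem_fieldGraph_of_ae_eq hJi hU⟩⟩

end Model

/-! ### Bounded measurable functions -/

section BoundedFunctions
variable {X : Type*} [MeasurableSpace X]

lemma norm_apply_le_boundedMeasurable (f : boundedMeasurable X) (x : X) : ‖f.1 x‖ ≤ ‖f‖ :=
  lp.norm_apply_le_norm (by simp) f.1 x

lemma measurable_boundedMeasurable (f : boundedMeasurable X) : Measurable fun x => f.1 x := f.2

/-- A bounded measurable function as an element of the algebra. -/
def bddFun (f : X → ℂ) (hf : Measurable f) (C : ℝ) (hC : ∀ x, ‖f x‖ ≤ C) : boundedMeasurable X :=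
  ⟨⟨f, memℓp_infty ⟨C, by rintro _ ⟨x, rfl⟩; exact hC x⟩⟩, hf⟩

lemma boundedMeasurable_ext {f g : boundedMeasurable X} (hfg : ∀ x, f.1 x = g.1 x) : f = g :=
  Subtype.ext (lp.ext (funext hfg))

lemma norm_boundedMeasurable_le {f : boundedMeasurable X} {C : ℝ} (hC : 0 ≤ C)
    (hf : ∀ x, ‖f.1 x‖ ≤ C) : ‖f‖ ≤ C :=
  lp.norm_le_of_forall_le hC hf

end BoundedFunctions

/-! ### The representation by multiplication operators -/

section Multiplication
open MeasureTheory
variable {X Ω : Type*} [MeasurableSpace X] [MeasurableSpace Ω] {μ : Measure Ω} {T : Ω → X}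

lemma memLp_comp_mul (hT : Measurable T) (f : boundedMeasurable X) (x : Lp ℂ 2 μ) :
    MemLp (fun ω => f.1 (T ω) * x ω) 2 μ := by
  refine (Lp.memLp x).of_le_mul (c := ‖f‖) ?_ (Filter.Eventually.of_forall fun ω => ?_)
  · exact ((measurable_boundedMeasurable f).comp hT).aestronglyMeasurable.mul
      (Lp.aestronglyMeasurable x)
  · rw [norm_mul]
    exact mul_le_mul_of_nonneg_right (norm_apply_le_boundedMeasurable f _) (norm_nonneg _)

/-- Multiplication by the bounded function `f ∘ T` on `L²`. -/
def mulOp (hT : Measurable T) (f : boundedMeasurable X) : Lp ℂ 2 μ →L[ℂ] Lp ℂ 2 μ :=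
  LinearMap.mkContinuous
    { toFun := fun x => (memLp_comp_mul hT f x).toLp
      map_add' := fun x y => by
        refine Lp.ext ?_
        filter_upwards [(memLp_comp_mul hT f (x + y)).coeFn_toLp,
          (memLp_comp_mul hT f x).coeFn_toLp, (memLp_comp_mul hT f y).coeFn_toLp,
          Lp.coeFn_add (memLp_comp_mul hT f x).toLp (memLp_comp_mul hT f y).toLp,
          Lp.coeFn_add x y] with ω h1 h2 h3 h4 h5
        rw [h1, h4, Pi.add_apply, h2, h3, h5, Pi.add_apply, mul_add]
      map_smul' := fun c x => by
        refine Lp.ext ?_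
        filter_upwards [(memLp_comp_mul hT f (c • x)).coeFn_toLp,
          (memLp_comp_mul hT f x).coeFn_toLp,
          Lp.coeFn_smul c (memLp_comp_mul hT f x).toLp, Lp.coeFn_smul c x] with ω h1 h2 h3 h4
        rw [RingHom.id_apply, h1, h3, Pi.smul_apply, h2, h4, Pi.smul_apply, smul_eq_mul,
          smul_eq_mul, mul_left_comm] }
    ‖f‖ fun x => by
      refine Lp.norm_le_mul_norm_of_ae_le_mul ?_
      filter_upwards [(memLp_comp_mul hT f x).coeFn_toLp] with ω h1
      refine (congrArg norm h1).le.trans ?_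
      rw [norm_mul]
      exact mul_le_mul_of_nonneg_right (norm_apply_le_boundedMeasurable f _) (norm_nonneg _)

lemma coeFn_mulOp (hT : Measurable T) (f : boundedMeasurable X) (x : Lp ℂ 2 μ) :
    ∀ᵐ ω ∂μ, mulOp hT f x ω = f.1 (T ω) * x ω :=
  (memLp_comp_mul hT f x).coeFn_toLp

lemma mulOp_star (hT : Measurable T) (f : boundedMeasurable X) :
    mulOp (μ := μ) hT (star f) = star (mulOp hT f) := by
  rw [ContinuousLinearMap.star_eq_adjoint, ContinuousLinearMap.eq_adjoint_iff]
  intro x y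
  rw [L2.inner_def, L2.inner_def]
  refine integral_congr_ae ?_
  filter_upwards [coeFn_mulOp hT (star f) x, coeFn_mulOp hT f y] with ω h1 h2
  have h3 : (star f).1 (T ω) = conj (f.1 (T ω)) := rfl
  rw [h1, h2, h3, RCLike.inner_apply, RCLike.inner_apply, map_mul, Complex.conj_conj]
  ring

/-- The multiplication operators by the functions `f ∘ T`. -/
def mulRep (hT : Measurable T) :
    boundedMeasurable X →⋆ₐ[ℂ] (Lp ℂ 2 μ →L[ℂ] Lp ℂ 2 μ) where
  toFun := mulOp hT
  map_one' := by
    ext1 x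
    refine Lp.ext ?_
    filter_upwards [coeFn_mulOp hT 1 x] with ω h1
    exact h1.trans (one_mul _)
  map_mul' f g := by
    ext1 x
    refine Lp.ext ?_
    filter_upwards [coeFn_mulOp hT (f * g) x, coeFn_mulOp hT f (mulOp hT g x),
      coeFn_mulOp hT g x] with ω h1 h2 h3
    rw [h1]
    refine Eq.trans ?_ h2.symm
    rw [h3, ← mul_assoc]
    rfl
  map_zero' := by
    ext1 x
    refine Lp.ext ?_
    filter_upwards [coeFn_mulOp hT 0 x, Lp.coeFn_zero ℂ 2 μ] with ω h1 h2
    exact h1.trans ((zero_mul _).trans h2.symm)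
  map_add' f g := by
    ext1 x
    refine Lp.ext ?_
    filter_upwards [coeFn_mulOp hT (f + g) x, coeFn_mulOp hT f x, coeFn_mulOp hT g x,
      Lp.coeFn_add (mulOp hT f x) (mulOp hT g x)] with ω h1 h2 h3 h4
    rw [h1]
    refine Eq.trans ?_ h4.symm
    rw [Pi.add_apply, h2, h3, ← add_mul]
    rfl
  commutes' c := by
    ext1 x
    refine Lp.ext ?_
    filter_upwards [coeFn_mulOp hT (algebraMap ℂ (boundedMeasurable X) c) x,
      Lp.coeFn_smul c x] with ω h1 h2
    rw [h1]
    refine Eq.trans ?_ h2.symm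
    rw [Pi.smul_apply, smul_eq_mul]
    congr 1
  map_star' := mulOp_star hT

lemma norm_sq_eq_integral (x : Lp ℂ 2 μ) : ‖x‖ ^ 2 = ∫ ω, ‖x ω‖ ^ 2 ∂μ := by
  have h1 : ⟪x, x⟫_ℂ = ((∫ ω, ‖x ω‖ ^ 2 ∂μ : ℝ) : ℂ) := by
    rw [L2.inner_def, ← integral_complex_ofReal]
    refine integral_congr_ae (Filter.Eventually.of_forall fun ω => ?_)
    simp only [inner_self_eq_norm_sq_to_K]
    push_cast
    rfl
  rw [inner_self_eq_norm_sq_to_K] at h1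
  exact Complex.ofReal_injective (by push_cast; exact h1)

lemma integrable_norm_sq (x : Lp ℂ 2 μ) : Integrable (fun ω => ‖x ω‖ ^ 2) μ :=
  (memLp_two_iff_integrable_sq_norm (Lp.aestronglyMeasurable x)).1 (Lp.memLp x)

lemma tendsto_mulOp (hT : Measurable T) {f : ℕ → boundedMeasurable X} {g : boundedMeasurable X}
    {C : ℝ} (hC : ∀ n, ‖f n‖ ≤ C)
    (hfg : ∀ α, Filter.Tendsto (fun n => (f n).1 α) Filter.atTop (nhds (g.1 α))) (x : Lp ℂ 2 μ) :
    Filter.Tendsto (fun n => mulOp hT (f n) x) Filter.atTop (nhds (mulOp hT g x)) := by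
  rw [tendsto_iff_norm_sub_tendsto_zero]
  have h1 : Filter.Tendsto (fun n => ‖mulOp hT (f n) x - mulOp hT g x‖ ^ 2) Filter.atTop
      (nhds 0) := by
    have h2 : ∀ n, ∀ᵐ ω ∂μ, (mulOp hT (f n) x - mulOp hT g x : Lp ℂ 2 μ) ω
        = ((f n).1 (T ω) - g.1 (T ω)) * x ω := fun n => by
      filter_upwards [Lp.coeFn_sub (mulOp hT (f n) x) (mulOp hT g x), coeFn_mulOp hT (f n) x,
        coeFn_mulOp hT g x] with ω h3 h4 h5
      rw [h3, Pi.sub_apply, h4, h5, sub_mul]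
    simp_rw [norm_sq_eq_integral]
    have h0 : (0 : ℝ) = ∫ _, (0 : ℝ) ∂μ := by simp
    rw [h0]
    refine tendsto_integral_of_dominated_convergence (fun ω => (C + ‖g‖) ^ 2 * ‖x ω‖ ^ 2)
      (fun n => (integrable_norm_sq _).aestronglyMeasurable) ((integrable_norm_sq x).const_mul _)
      (fun n => ?_) ?_
    · filter_upwards [h2 n] with ω h3
      rw [h3, norm_mul, Real.norm_of_nonneg (by positivity), mul_pow]
      gcongr
      exact (norm_sub_le _ _).trans (add_le_add
        ((norm_apply_le_boundedMeasurable _ _).trans (hC n)) (norm_apply_le_boundedMeasurable _ _))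
    · filter_upwards [ae_all_iff.2 h2] with ω h3
      simp_rw [h3]
      have h4 := (((hfg (T ω)).sub_const (g.1 (T ω))).mul_const (x ω)).norm.pow 2
      simpa using h4
  have h2 := (Real.continuous_sqrt.tendsto 0).comp h1
  simpa [Function.comp_def, Real.sqrt_sq] using h2

end Multiplication

/-! ### A version of the random field with antilinear sample functionals -/

section Sampling
open MeasureTheory
variable {h : Type*} [NormedAddCommGroup h] [InnerProductSpace ℂ h]
variable {Ω : Type*} [MeasurableSpace Ω] {μ : Measure Ω}

lemma measurable_eval_classicalField (φ : h) : Measurable fun α : ClassicalField h => α φ :=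
  measurable_iff_comap_le.2 (le_iSup (fun φ : h =>
    MeasurableSpace.comap (fun α : ClassicalField h => α φ) inferInstance) φ)

lemma measurable_classicalField_iff {Ω' : Type*} {m : MeasurableSpace Ω'}
    {T : Ω' → ClassicalField h} :
    Measurable T ↔ ∀ φ, Measurable fun ω => T ω φ := by
  refine ⟨fun hT φ => (measurable_eval_classicalField φ).comp hT, fun hT => ?_⟩
  rw [measurable_iff_comap_le]
  change MeasurableSpace.comap T (⨆ φ : h, _) ≤ _
  rw [MeasurableSpace.comap_iSup]
  refine iSup_le fun φ => ?_
  rw [MeasurableSpace.comap_comp]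
  exact (hT φ).comap_le

/-- A square integrable antilinear random field has a version with values in the antilinear
functionals. -/
lemma exists_sampling (z : h →ₗ⋆[ℂ] Lp ℂ 2 μ) :
    ∃ T : Ω → ClassicalField h, Measurable T ∧ ∀ φ, ∀ᵐ ω ∂μ, T ω φ = z φ ω := by
  -- Representatives are chosen on an algebraic basis only and extended antilinearly for each `ω`. A
  -- given `φ` involves finitely many basis vectors, so the exceptional set is null, though it may
  -- depend on `φ`.
  let B := Module.Basis.ofVectorSpace ℂ h
  let T : Ω → ClassicalField h := fun ω =>
    (starLinearEquiv ℂ (A := ℂ)).toLinearMap.comp (B.constr ℂ fun i => conj (z (B i) ω))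
  have hT : ∀ ω φ, T ω φ = ∑ i ∈ (B.repr φ).support, conj (B.repr φ i) * z (B i) ω :=
    fun ω φ => by
      change conj (B.constr ℂ (fun i => conj (z (B i) ω)) φ) = _
      rw [Module.Basis.constr_apply, Finsupp.sum, map_sum]
      refine Finset.sum_congr rfl fun i _ => ?_
      rw [smul_eq_mul, map_mul, Complex.conj_conj]
  refine ⟨T, measurable_classicalField_iff.2 fun φ => ?_, fun φ => ?_⟩
  · simp_rw [hT]
    exact Finset.measurable_sum _ fun i _ => (Lp.stronglyMeasurable (z (B i))).measurable.const_mul _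
  · have h1 : z φ = ∑ i ∈ (B.repr φ).support, conj (B.repr φ i) • z (B i) := by
      conv_lhs => rw [← B.linearCombination_repr φ, Finsupp.linearCombination_apply, Finsupp.sum]
      simp only [map_sum, map_smulₛₗ]
    have h2 := Lp.coeFn_fun_finsetSum (B.repr φ).support
      (fun i => conj (B.repr φ i) • z (B i))
    rw [← h1] at h2
    have h3 : ∀ i ∈ (B.repr φ).support, ∀ᵐ ω ∂μ,
        (conj (B.repr φ i) • z (B i) : Lp ℂ 2 μ) ω = conj (B.repr φ i) * z (B i) ω :=
      fun i _ => Lp.coeFn_smul (conj (B.repr φ i)) (z (B i))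
    filter_upwards [h2, (Finset.eventually_all _).2 h3] with ω h4 h5
    rw [h4, hT]
    exact (Finset.sum_congr rfl h5).symm

end Sampling

/-! ### Existence of the functional calculus -/

section Existence
open MeasureTheory
variable {h : Type*} [NormedAddCommGroup h] [InnerProductSpace ℂ h] {J : h → h}
variable {Ω : Type*} [MeasurableSpace Ω] {μ : Measure Ω}
  {U : Lp ℂ 2 μ ≃ₗᵢ[ℂ] DoubleFock h} {z : h →ₗ⋆[ℂ] Lp ℂ 2 μ}

/-- `Submodule.toLinearPMap` has the given graph only if that graph is single-valued, that is, if
the field is closable; the multiplication model shows this. -/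
lemma fieldZ_eq_iff (hU : ∀ χ x y, (U x, U y) ∈ fieldGraph J χ ↔ ∀ᵐ ω ∂μ, y ω = z χ ω * x ω)
    (χ : h) (x y : DoubleFock h) :
    (∃ hx : x ∈ (fieldZ J χ).domain, fieldZ J χ ⟨x, hx⟩ = y) ↔ (x, y) ∈ fieldGraph J χ := by
  have hg : ∀ p : DoubleFock h × DoubleFock h, p ∈ fieldGraph J χ → p.1 = 0 → p.2 = 0 := by
    intro p hp hp1
    have h1 : (U (U.symm p.1), U (U.symm p.2)) ∈ fieldGraph J χ := by
      rw [U.apply_symm_apply, U.apply_symm_apply]; exact hp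
    rw [hU, hp1, map_zero] at h1
    have h2 : U.symm p.2 = 0 := by
      refine (Lp.eq_zero_iff_ae_eq_zero).2 ?_
      filter_upwards [h1, Lp.coeFn_zero ℂ 2 μ] with ω h3 h4
      rw [h3, h4, Pi.zero_apply, mul_zero]
    exact (map_eq_zero_iff U.symm U.symm.injective).1 h2
  have h1 := Submodule.toLinearPMap_graph_eq (fieldGraph J χ) hg
  rw [← h1, LinearPMap.mem_graph_iff]
  constructor
  · rintro ⟨hx, hy⟩
    exact ⟨⟨x, hx⟩, rfl, hy⟩
  · rintro ⟨⟨x', hx'⟩, rfl, hy⟩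
    exact ⟨hx', hy⟩

lemma isFieldCalculus_conj_mulRep
    (hU : ∀ χ x y, (U x, U y) ∈ fieldGraph J χ ↔ ∀ᵐ ω ∂μ, y ω = z χ ω * x ω)
    {T : Ω → ClassicalField h} (hT : Measurable T) (hTz : ∀ φ, ∀ᵐ ω ∂μ, T ω φ = z φ ω) :
    IsFieldCalculus J
      ((U.conjStarAlgEquiv : (Lp ℂ 2 μ →L[ℂ] Lp ℂ 2 μ) →⋆ₐ[ℂ] _).comp (mulRep hT)) where
  tendsto f g C hC hfg x :=
    (U.continuous.tendsto _).comp (tendsto_mulOp hT hC hfg (U.symm x))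
  field φ f g hfg x := by
    rw [fieldZ_eq_iff hU]
    refine (hU φ (mulOp hT f (U.symm x)) (mulOp hT g (U.symm x))).2 ?_
    filter_upwards [hTz φ, coeFn_mulOp hT f (U.symm x), coeFn_mulOp hT g (U.symm x)]
      with ω h1 h2 h3
    rw [h3, hfg, h1, h2, mul_assoc]

end Existence

/-! ### Indicator and simple functions -/

section Indicators
open MeasureTheory
variable {X : Type*} [MeasurableSpace X]

/-- The indicator function of a measurable set. -/
def indFun {S : Set X} (hS : MeasurableSet S) : boundedMeasurable X :=
  bddFun (S.indicator fun _ => 1) (measurable_const.indicator hS) 1 fun x => by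
    by_cases hx : x ∈ S <;> simp [hx]

lemma indFun_apply {S : Set X} (hS : MeasurableSet S) (x : X) :
    (indFun hS).1 x = S.indicator (fun _ => 1) x := rfl

lemma norm_indFun_le {S : Set X} (hS : MeasurableSet S) : ‖indFun hS‖ ≤ 1 :=
  norm_boundedMeasurable_le zero_le_one fun x => by
    rw [indFun_apply]; by_cases hx : x ∈ S <;> simp [hx]

lemma indFun_mul {S T : Set X} (hS : MeasurableSet S) (hT : MeasurableSet T) (hST : T ⊆ S) :
    indFun hS * indFun hT = indFun hT := by
  refine boundedMeasurable_ext fun x => ?_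
  change (indFun hS).1 x * (indFun hT).1 x = (indFun hT).1 x
  simp only [indFun_apply]
  by_cases hx : x ∈ T
  · simp [hx, hST hx]
  · simp [hx]

lemma indFun_mul_compl {S : Set X} (hS : MeasurableSet S) : indFun hS * indFun hS.compl = 0 := by
  refine boundedMeasurable_ext fun x => ?_
  change (indFun hS).1 x * (indFun hS.compl).1 x = 0
  simp only [indFun_apply]
  by_cases hx : x ∈ S <;> simp [hx]

lemma indFun_add_compl {S : Set X} (hS : MeasurableSet S) :
    indFun hS + indFun hS.compl = 1 := by
  refine boundedMeasurable_ext fun x => ?_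
  change (indFun hS).1 x + (indFun hS.compl).1 x = 1
  simp only [indFun_apply]
  by_cases hx : x ∈ S <;> simp [hx]

lemma indFun_union {S T : Set X} (hS : MeasurableSet S) (hT : MeasurableSet T) :
    indFun (hS.union hT) = indFun hS + indFun hT * indFun hS.compl := by
  refine boundedMeasurable_ext fun x => ?_
  change (indFun (hS.union hT)).1 x
    = (indFun hS).1 x + (indFun hT).1 x * (indFun hS.compl).1 x
  simp only [indFun_apply]
  by_cases hx : x ∈ S <;> by_cases hx' : x ∈ T <;> simp [hx, hx']

lemma tendsto_indFun_accumulate {S : ℕ → Set X} (hS : ∀ n, MeasurableSet (S n))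
    (hA : ∀ n, MeasurableSet (Set.accumulate S n)) (x : X) :
    Filter.Tendsto (fun n => (indFun (hA n)).1 x) Filter.atTop
      (nhds ((indFun (MeasurableSet.iUnion hS)).1 x)) := by
  simp only [indFun_apply]
  have h1 := (Set.monotone_accumulate (s := S)).tendsto_indicator (Set.accumulate S)
    (fun _ : X => (1 : ℂ)) x
  rw [Set.iUnion_accumulate] at h1
  exact h1.mono_right (pure_le_nhds _)

/-- The bounded function given by a simple function. -/
def simpleFun (s : SimpleFunc X ℂ) : boundedMeasurable X :=
  bddFun s s.measurable s.exists_forall_norm_le.choose s.exists_forall_norm_le.choose_spec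

lemma simpleFun_apply (s : SimpleFunc X ℂ) (x : X) : (simpleFun s).1 x = s x := rfl

end Indicators

/-! ### Comparison of two normal representations on indicators -/

section NormalRep
open MeasureTheory
variable {X : Type*} [MeasurableSpace X]
variable {H : Type*} [NormedAddCommGroup H] [InnerProductSpace ℂ H] [CompleteSpace H]

/-- Continuity for bounded pointwise convergence and strong convergence. -/
def IsNormalRep (Φ : boundedMeasurable X →⋆ₐ[ℂ] (H →L[ℂ] H)) : Prop :=
  ∀ (f : ℕ → boundedMeasurable X) (g : boundedMeasurable X) (C : ℝ), (∀ n, ‖f n‖ ≤ C) →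
    (∀ x, Filter.Tendsto (fun n => (f n).1 x) Filter.atTop (nhds (g.1 x))) →
    ∀ u, Filter.Tendsto (fun n => Φ (f n) u) Filter.atTop (nhds (Φ g u))

variable {P Q : boundedMeasurable X →⋆ₐ[ℂ] (H →L[ℂ] H)}

lemma IsNormalRep.tendsto_accumulate (hP : IsNormalRep P) {S : ℕ → Set X}
    (hS : ∀ n, MeasurableSet (S n)) (hA : ∀ n, MeasurableSet (Set.accumulate S n)) (u : H) :
    Filter.Tendsto (fun n => P (indFun (hA n)) u) Filter.atTop
      (nhds (P (indFun (MeasurableSet.iUnion hS)) u)) :=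
  hP _ _ 1 (fun _ => norm_indFun_le _) (tendsto_indFun_accumulate hS hA) u

lemma IsNormalRep.ext_of_simpleFun (hP : IsNormalRep P) (hQ : IsNormalRep Q)
    (hPQ : ∀ s, P (simpleFun s) = Q (simpleFun s)) : P = Q := by
  ext1 f
  ext1 u
  have hf : StronglyMeasurable fun x => f.1 x := (measurable_boundedMeasurable f).stronglyMeasurable
  have h1 : ∀ n, ‖simpleFun (hf.approxBounded ‖f‖ n)‖ ≤ ‖f‖ := fun n =>
    norm_boundedMeasurable_le (norm_nonneg _) fun x =>
      hf.norm_approxBounded_le (norm_nonneg f) n x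
  have h2 : ∀ x, Filter.Tendsto (fun n => (simpleFun (hf.approxBounded ‖f‖ n)).1 x) Filter.atTop
      (nhds (f.1 x)) := fun x =>
    hf.tendsto_approxBounded_of_norm_le (norm_apply_le_boundedMeasurable f x)
  refine tendsto_nhds_unique (hP _ f _ h1 h2 u) ?_
  simp_rw [hPQ]
  exact hQ _ f _ h1 h2 u

lemma IsNormalRep.ext_of_indFun (hP : IsNormalRep P) (hQ : IsNormalRep Q)
    (hPQ : ∀ (S : Set X) (hS : MeasurableSet S), P (indFun hS) = Q (indFun hS)) : P = Q := by
  refine hP.ext_of_simpleFun hQ fun s => ?_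
  induction s using SimpleFunc.induction with
  | @const c S hS =>
    have h1 : simpleFun (SimpleFunc.piecewise S hS (SimpleFunc.const X c) (SimpleFunc.const X 0))
        = c • indFun hS := by
      refine boundedMeasurable_ext fun x => ?_
      change _ = c • (indFun hS).1 x
      rw [simpleFun_apply, indFun_apply]
      by_cases hx : x ∈ S <;> simp [hx]
    rw [h1, map_smul, map_smul, hPQ]
  | @add f g _ hf hg =>
    have h1 : simpleFun (f + g) = simpleFun f + simpleFun g := boundedMeasurable_ext fun x => rfl
    rw [h1, map_add, map_add, hf, hg]

lemma measurableSet_accumulate {S : ℕ → Set X} (hS : ∀ n, MeasurableSet (S n)) (n : ℕ) :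
    MeasurableSet (Set.accumulate S n) :=
  MeasurableSet.biUnion (Set.to_countable _) fun i _ => hS i

/-- The σ-algebra of the measurable sets whose indicators have the same image under two
normal representations. -/
@[reducible] def IsNormalRep.agreement (hP : IsNormalRep P) (hQ : IsNormalRep Q) : MeasurableSpace X where
  MeasurableSet' S := ∃ hS : MeasurableSet S, P (indFun hS) = Q (indFun hS)
  measurableSet_empty := ⟨MeasurableSet.empty, by
    have h1 : indFun (MeasurableSet.empty (α := X)) = 0 :=
      boundedMeasurable_ext fun x => by
        rw [indFun_apply, Set.indicator_empty]; rfl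
    rw [h1, map_zero, map_zero]⟩
  measurableSet_compl S := fun ⟨hS, h1⟩ => ⟨hS.compl, by
    rw [eq_sub_of_add_eq' (indFun_add_compl hS), map_sub, map_sub, h1, map_one, map_one]⟩
  measurableSet_iUnion S hS := by
    choose hS hPQ using hS
    refine ⟨MeasurableSet.iUnion hS, ?_⟩
    -- Partial unions are polynomial in the indicators, so no disjointness is needed; the full union
    -- is then a strong limit.
    have h1 : ∀ n, P (indFun (measurableSet_accumulate hS n))
        = Q (indFun (measurableSet_accumulate hS n)) := by
      intro n
      induction n with
      | zero => simpa only [Set.accumulate_zero_nat] using hPQ 0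
      | succ n ih =>
        have h2 := indFun_union (measurableSet_accumulate hS n) (hS (n + 1))
        simp only [Set.accumulate_succ, h2, map_add, map_mul, ih, hPQ,
          eq_sub_of_add_eq' (indFun_add_compl (measurableSet_accumulate hS n)), map_sub, map_one]
    ext1 u
    refine tendsto_nhds_unique (hP.tendsto_accumulate hS (measurableSet_accumulate hS) u) ?_
    simp_rw [h1]
    exact hQ.tendsto_accumulate hS (measurableSet_accumulate hS) u

variable (P Q) in
/-- `P(S)` is below the projection `Q(S)`. -/
def Dominated (S : Set X) : Prop :=
  ∃ hS : MeasurableSet S, Q (indFun hS) * P (indFun hS) = P (indFun hS)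

lemma Dominated.mul_eq {S T : Set X} (h1 : Dominated P Q S) (hS : MeasurableSet S)
    (hT : MeasurableSet T) (hST : S ⊆ T) : Q (indFun hT) * P (indFun hS) = P (indFun hS) := by
  obtain ⟨_, h2⟩ := h1
  rw [← h2, ← mul_assoc, ← map_mul, indFun_mul hT hS hST]

lemma Dominated.union {S T : Set X} (hS : Dominated P Q S) (hT : Dominated P Q T) :
    Dominated P Q (S ∪ T) := by
  refine ⟨hS.1.union hT.1, ?_⟩
  have h1 : P (indFun (hS.1.union hT.1))
      = P (indFun hS.1) + P (indFun hT.1) * P (indFun hS.1.compl) := by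
    rw [indFun_union hS.1 hT.1, map_add, map_mul]
  rw [h1, mul_add, hS.mul_eq hS.1 _ Set.subset_union_left, ← mul_assoc,
    hT.mul_eq hT.1 _ Set.subset_union_right]

lemma Dominated.iUnion (hP : IsNormalRep P) {S : ℕ → Set X} (hS : ∀ n, Dominated P Q (S n)) :
    Dominated P Q (⋃ n, S n) := by
  have hA : ∀ n, Dominated P Q (Set.accumulate S n) := by
    intro n
    induction n with
    | zero => simpa only [Set.accumulate_zero_nat] using hS 0
    | succ n ih => simpa only [Set.accumulate_succ] using ih.union (hS (n + 1))
  refine ⟨MeasurableSet.iUnion fun n => (hS n).1, ?_⟩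
  ext1 u
  have h1 := hP.tendsto_accumulate (fun n => (hS n).1) (fun n => (hA n).1) u
  refine tendsto_nhds_unique
    (((Q (indFun (MeasurableSet.iUnion fun n => (hS n).1))).continuous.tendsto _).comp h1) ?_
  refine h1.congr fun n => ?_
  exact (congrFun (congrArg DFunLike.coe ((hA n).mul_eq (hA n).1
    (MeasurableSet.iUnion fun n => (hS n).1) (Set.accumulate_subset_iUnion n))) u).symm

/-- Domination on the complement makes `Q(S) P(Sᶜ)` vanish, so `Q(S) = Q(S) (P(S) + P(Sᶜ)) = Q(S)
P(S) = P(S)`. One-sided estimates therefore suffice. -/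
lemma Dominated.eq {S : Set X} (hS : Dominated P Q S) (hS' : Dominated P Q Sᶜ) :
    P (indFun hS.1) = Q (indFun hS.1) := by
  have h1 : Q (indFun hS.1) * P (indFun hS.1.compl) = 0 := by
    obtain ⟨_, h2⟩ := hS'
    rw [← h2, ← mul_assoc, ← map_mul, indFun_mul_compl, map_zero, zero_mul]
  have h2 : Q (indFun hS.1) * (P (indFun hS.1) + P (indFun hS.1.compl)) = Q (indFun hS.1) := by
    rw [← map_add, indFun_add_compl, map_one, mul_one]
  rw [mul_add, h1, add_zero, hS.mul_eq hS.1 hS.1 subset_rfl] at h2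
  exact h2

end NormalRep

/-! ### Uniqueness of the functional calculus -/

section Disc
open MeasureTheory
variable {h : Type*} [NormedAddCommGroup h] [InnerProductSpace ℂ h]
variable {Ω : Type*} [MeasurableSpace Ω] {μ : Measure Ω} {T : Ω → ClassicalField h}

/-- The sequence of functions `(α(φ) - c)ⁿ` on the disc `‖α(φ) - c‖ ≤ R`. -/
def discPow (φ : h) (c : ℂ) (R : ℝ) (n : ℕ) : boundedMeasurable (ClassicalField h) :=
  bddFun ({α : ClassicalField h | ‖α φ - c‖ ≤ R}.indicator fun α => (α φ - c) ^ n)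
    ((((measurable_eval_classicalField φ).sub_const c).pow_const n).indicator
      (measurableSet_le ((measurable_eval_classicalField φ).sub_const c).norm measurable_const))
    (|R| ^ n) fun α => by
      by_cases hα : ‖α φ - c‖ ≤ R
      · rw [Set.indicator_of_mem (by exact hα), norm_pow]
        exact pow_le_pow_left₀ (norm_nonneg _) (hα.trans (le_abs_self R)) n
      · rw [Set.indicator_of_notMem (by exact hα), norm_zero]
        positivity

lemma discPow_apply (φ : h) (c : ℂ) (R : ℝ) (n : ℕ) (α : ClassicalField h) :
    (discPow φ c R n).1 α
      = {α : ClassicalField h | ‖α φ - c‖ ≤ R}.indicator (fun α => (α φ - c) ^ n) α := rfl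

lemma norm_discPow_le (φ : h) (c : ℂ) (R : ℝ) (n : ℕ) : ‖discPow φ c R n‖ ≤ |R| ^ n := by
  refine norm_boundedMeasurable_le (by positivity) fun α => ?_
  rw [discPow_apply]
  by_cases hα : ‖α φ - c‖ ≤ R
  · rw [Set.indicator_of_mem (by exact hα), norm_pow]
    exact pow_le_pow_left₀ (norm_nonneg _) (hα.trans (le_abs_self R)) n
  · rw [Set.indicator_of_notMem (by exact hα), norm_zero]
    positivity

/-- A square integrable function that stays bounded by `C Rⁿ` in norm when it is multiplied by
`wⁿ` vanishes almost everywhere on `R < ‖w‖`. -/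
lemma ae_eq_zero_of_norm_pow_le {w : Ω → ℂ} (hw : Measurable w) {y : ℕ → Lp ℂ 2 μ}
    (hy : ∀ n, ∀ᵐ ω ∂μ, y n ω = w ω ^ n * y 0 ω) {R C : ℝ} (hR : 0 ≤ R)
    (hn : ∀ n, ‖y n‖ ≤ R ^ n * C) : ∀ᵐ ω ∂μ, R < ‖w ω‖ → y 0 ω = 0 := by
  have key : ∀ q, R < q → ∀ᵐ ω ∂μ, q ≤ ‖w ω‖ → y 0 ω = 0 := by
    intro q hq
    have hq0 : 0 < q := hR.trans_lt hq
    have hA : MeasurableSet {ω | q ≤ ‖w ω‖} := measurableSet_le measurable_const hw.norm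
    -- Chebyshev: on this set `‖y 0‖ ≤ q⁻ⁿ ‖y n‖`, and the bound tends to `0` because `R < q`.
    have h1 : ∀ n, ∫ ω in {ω | q ≤ ‖w ω‖}, ‖y 0 ω‖ ^ 2 ∂μ ≤ ((R / q) ^ 2) ^ n * C ^ 2 := by
      intro n
      have h2 : ∫ ω in {ω | q ≤ ‖w ω‖}, ‖y 0 ω‖ ^ 2 ∂μ
          ≤ ∫ ω in {ω | q ≤ ‖w ω‖}, (q ^ n)⁻¹ ^ 2 * ‖y n ω‖ ^ 2 ∂μ := by
        refine setIntegral_mono_on_ae (integrable_norm_sq (y 0)).integrableOn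
          ((integrable_norm_sq (y n)).const_mul _).integrableOn hA ?_
        filter_upwards [hy n] with ω h3 h4
        rw [h3, norm_mul, norm_pow, mul_pow, ← mul_assoc, ← mul_pow]
        refine le_mul_of_one_le_left (by positivity) (one_le_pow₀ ?_)
        rw [inv_mul_eq_div, one_le_div (by positivity)]
        exact pow_le_pow_left₀ hq0.le h4 n
      refine h2.trans ((setIntegral_le_integral ((integrable_norm_sq (y n)).const_mul _)
        (Filter.Eventually.of_forall fun ω => by positivity)).trans ?_)
      rw [integral_const_mul, ← norm_sq_eq_integral]
      calc (q ^ n)⁻¹ ^ 2 * ‖y n‖ ^ 2 ≤ (q ^ n)⁻¹ ^ 2 * (R ^ n * C) ^ 2 := by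
            gcongr
            exact hn n
        _ = ((R / q) ^ 2) ^ n * C ^ 2 := by
            rw [div_pow, div_pow, mul_pow, ← pow_mul, ← pow_mul, ← pow_mul, mul_comm 2 n, inv_pow,
              ← pow_mul]
            ring
    have h2 : Filter.Tendsto (fun n : ℕ => ((R / q) ^ 2) ^ n * C ^ 2) Filter.atTop (nhds 0) := by
      have h3 : (R / q) ^ 2 < 1 :=
        pow_lt_one₀ (by positivity) ((div_lt_one hq0).2 hq) two_ne_zero
      simpa using (tendsto_pow_atTop_nhds_zero_of_lt_one (by positivity) h3).mul_const (C ^ 2)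
    have h3 : ∫ ω in {ω | q ≤ ‖w ω‖}, ‖y 0 ω‖ ^ 2 ∂μ = 0 :=
      le_antisymm (ge_of_tendsto' h2 h1) (integral_nonneg fun ω => by positivity)
    rw [setIntegral_eq_zero_iff_of_nonneg_ae
      (Filter.Eventually.of_forall fun ω => by positivity)
      (integrable_norm_sq (y 0)).integrableOn] at h3
    filter_upwards [(ae_restrict_iff' hA).1 h3] with ω h4 h5
    simpa using h4 h5
  filter_upwards [ae_all_iff.2 fun n : ℕ => key (R + 1 / (n + 1))
    (lt_add_of_pos_right _ (by positivity))] with ω h1 h2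
  obtain ⟨n, hn⟩ := exists_nat_one_div_lt (sub_pos.2 h2)
  exact h1 n (by linarith)

variable {P : boundedMeasurable (ClassicalField h) →⋆ₐ[ℂ] (Lp ℂ 2 μ →L[ℂ] Lp ℂ 2 μ)}

/-- The field property gives `P((α(φ) - c)ⁿ 1_D) x = (T φ - c)ⁿ P(1_D) x`, while contractivity of
`*`-homomorphisms bounds its norm by `Rⁿ ‖x‖`. Hence `P(1_D) x` vanishes where `‖T φ - c‖ > R`. -/
lemma dominated_disc (hT : Measurable T)
    (hfield : ∀ (φ : h) (f g : boundedMeasurable (ClassicalField h)),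
      (∀ α, g.1 α = α φ * f.1 α) → ∀ x, ∀ᵐ ω ∂μ, P g x ω = T ω φ * P f x ω)
    (φ : h) (c : ℂ) {R : ℝ} (hR : 0 ≤ R) :
    Dominated P (mulRep hT) {α : ClassicalField h | ‖α φ - c‖ ≤ R} := by
  have hS : MeasurableSet {α : ClassicalField h | ‖α φ - c‖ ≤ R} :=
    measurableSet_le ((measurable_eval_classicalField φ).sub_const c).norm measurable_const
  refine ⟨hS, ?_⟩
  have hw : Measurable fun ω => T ω φ - c :=
    ((measurable_eval_classicalField φ).comp hT).sub_const c
  ext1 x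
  have h0 : discPow φ c R 0 = indFun hS := boundedMeasurable_ext fun α => by
    rw [discPow_apply, indFun_apply]; simp
  have h1 : ∀ n, ∀ᵐ ω ∂μ, P (discPow φ c R (n + 1)) x ω
      = (T ω φ - c) * P (discPow φ c R n) x ω := by
    intro n
    -- The field property concerns multiplication by `α(φ)`, not by `α(φ) - c`; hence the added
    -- multiple of `c`.
    have h2 := hfield φ (discPow φ c R n) (discPow φ c R (n + 1) + c • discPow φ c R n)
      (fun α => by
        change (discPow φ c R (n + 1)).1 α + c * (discPow φ c R n).1 α = _
        simp only [discPow_apply]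
        by_cases hα : ‖α φ - c‖ ≤ R
        · rw [Set.indicator_of_mem (by exact hα), Set.indicator_of_mem (by exact hα)]
          ring
        · rw [Set.indicator_of_notMem (by exact hα), Set.indicator_of_notMem (by exact hα)]
          ring) x
    rw [map_add, map_smul] at h2
    filter_upwards [h2, Lp.coeFn_add (P (discPow φ c R (n + 1)) x) (c • P (discPow φ c R n) x),
      Lp.coeFn_smul c (P (discPow φ c R n) x)] with ω h3 h4 h5
    have h6 := h4.symm.trans h3
    rw [Pi.add_apply, h5, Pi.smul_apply, smul_eq_mul] at h6
    rw [sub_mul, ← h6, add_sub_cancel_right]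
  have h2 : ∀ n, ∀ᵐ ω ∂μ, P (discPow φ c R n) x ω
      = (T ω φ - c) ^ n * P (discPow φ c R 0) x ω := by
    intro n
    induction n with
    | zero => exact Filter.Eventually.of_forall fun ω => by rw [pow_zero, one_mul]
    | succ n ih =>
      filter_upwards [ih, h1 n] with ω h3 h4
      rw [h4, h3, pow_succ']
      ring
  have h3 := ae_eq_zero_of_norm_pow_le hw (y := fun n => P (discPow φ c R n) x) h2 hR
    (C := ‖x‖) fun n => by
      refine ((P (discPow φ c R n)).le_opNorm x).trans ?_
      gcongr
      refine (NonUnitalStarAlgHom.norm_apply_le P _).trans ?_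
      simpa only [abs_of_nonneg hR] using norm_discPow_le φ c R n
  refine Lp.ext ?_
  filter_upwards [h3, coeFn_mulOp hT (indFun hS) (P (indFun hS) x)] with ω h4 h5
  refine h5.trans ?_
  rw [indFun_apply]
  by_cases hω : ‖T ω φ - c‖ ≤ R
  · rw [Set.indicator_of_mem (by exact hω), one_mul]
  · rw [Set.indicator_of_notMem (by exact hω), zero_mul, ← h0]
    exact (h4 (not_le.1 hω)).symm

/-- Every open set of the plane is a countable union of closed discs. -/
lemma exists_iUnion_closedBall {O : Set ℂ} (hO : IsOpen O) (hne : O.Nonempty) :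
    ∃ (c : ℕ → ℂ) (r : ℕ → ℝ), (∀ n, 0 ≤ r n) ∧ ⋃ n, Metric.closedBall (c n) (r n) = O := by
  let I : Set (ℕ × ℕ) := {p | Metric.closedBall (TopologicalSpace.denseSeq ℂ p.1)
    (1 / ((p.2 : ℝ) + 1)) ⊆ O}
  have hI : ∀ x ∈ O, ∃ p ∈ I, x ∈ Metric.closedBall (TopologicalSpace.denseSeq ℂ p.1)
      (1 / ((p.2 : ℝ) + 1)) := by
    intro x hx
    obtain ⟨ε, hε, hεO⟩ := Metric.isOpen_iff.1 hO x hx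
    obtain ⟨m, hm⟩ := exists_nat_one_div_lt (half_pos hε)
    obtain ⟨k, hk⟩ := (TopologicalSpace.denseRange_denseSeq ℂ).exists_dist_lt x
      (show (0 : ℝ) < 1 / ((m : ℝ) + 1) by positivity)
    refine ⟨(k, m), fun y hy => hεO ?_, hk.le⟩
    rw [Metric.mem_closedBall] at hy
    rw [Metric.mem_ball]
    have h1 := dist_triangle_right y x (TopologicalSpace.denseSeq ℂ k)
    dsimp only at hy
    linarith
  obtain ⟨x, hx⟩ := hne
  obtain ⟨p, hp, -⟩ := hI x hx
  obtain ⟨e, he⟩ := (Set.to_countable I).exists_eq_range ⟨p, hp⟩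
  refine ⟨fun n => TopologicalSpace.denseSeq ℂ (e n).1, fun n => 1 / (((e n).2 : ℝ) + 1),
    fun n => by positivity, Set.Subset.antisymm (Set.iUnion_subset fun n => ?_) fun y hy => ?_⟩
  · have h1 : e n ∈ I := he ▸ Set.mem_range_self n
    exact h1
  · obtain ⟨q, hq, hyq⟩ := hI y hy
    rw [he] at hq
    obtain ⟨n, rfl⟩ := hq
    exact Set.mem_iUnion.2 ⟨n, hyq⟩

lemma dominated_open (hP : IsNormalRep P) (hT : Measurable T)
    (hfield : ∀ (φ : h) (f g : boundedMeasurable (ClassicalField h)),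
      (∀ α, g.1 α = α φ * f.1 α) → ∀ x, ∀ᵐ ω ∂μ, P g x ω = T ω φ * P f x ω)
    (φ : h) {O : Set ℂ} (hO : IsOpen O) :
    Dominated P (mulRep hT) {α : ClassicalField h | α φ ∈ O} := by
  rcases O.eq_empty_or_nonempty with rfl | hne
  · refine ⟨MeasurableSet.empty, ?_⟩
    have h1 : indFun (MeasurableSet.empty (α := ClassicalField h)) = 0 :=
      boundedMeasurable_ext fun x => by
        rw [indFun_apply, Set.indicator_empty]; rfl
    change mulRep hT (indFun MeasurableSet.empty) * P (indFun MeasurableSet.empty)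
      = P (indFun MeasurableSet.empty)
    rw [h1, map_zero, map_zero, zero_mul]
  · obtain ⟨c, r, hr, rfl⟩ := exists_iUnion_closedBall hO hne
    have h1 := Dominated.iUnion hP fun n => dominated_disc hT hfield φ (c n) (hr n)
    convert! h1 using 1
    ext α
    simp [dist_eq_norm]

/-- For a closed disc, domination holds for it and for its open complement, so the two
representations agree there; closed discs generate the open sets of the plane, and these generate
the σ-algebra of the fields. -/
lemma eq_mulRep (hP : IsNormalRep P) (hT : Measurable T)
    (hfield : ∀ (φ : h) (f g : boundedMeasurable (ClassicalField h)),
      (∀ α, g.1 α = α φ * f.1 α) → ∀ x, ∀ᵐ ω ∂μ, P g x ω = T ω φ * P f x ω) :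
    P = mulRep hT := by
  have hQ : IsNormalRep (mulRep (μ := μ) hT) := fun f g C hC hfg u => tendsto_mulOp hT hC hfg u
  have h1 : (inferInstance : MeasurableSpace (ClassicalField h)) ≤ hP.agreement hQ := by
    refine iSup_le fun φ => ?_
    rw [← measurable_iff_comap_le]
    refine @measurable_of_isOpen _ _ _ _ _ (hP.agreement hQ) _ fun O hO => ?_
    rcases O.eq_empty_or_nonempty with rfl | hne
    · exact @MeasurableSet.empty _ (hP.agreement hQ)
    obtain ⟨c, r, hr, rfl⟩ := exists_iUnion_closedBall hO hne
    rw [Set.preimage_iUnion]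
    refine @MeasurableSet.iUnion _ _ (hP.agreement hQ) _ _ fun n => ?_
    have h2 := dominated_disc (P := P) hT hfield φ (c n) (hr n)
    have h3 : (fun α : ClassicalField h => α φ) ⁻¹' Metric.closedBall (c n) (r n)
        = {α : ClassicalField h | ‖α φ - c n‖ ≤ r n} := by
      ext α
      simp [dist_eq_norm]
    rw [h3]
    refine ⟨h2.1, h2.eq ?_⟩
    rw [← h3]
    exact dominated_open hP hT hfield φ Metric.isClosed_closedBall.isOpen_compl
  exact hP.ext_of_indFun hQ fun S hS => (h1 S hS).2

end Disc


/-! ### Complete positivity of compressions -/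

section Compression
open ContinuousLinearMap
variable {H K : Type*} [NormedAddCommGroup H] [InnerProductSpace ℂ H] [CompleteSpace H]
  [NormedAddCommGroup K] [InnerProductSpace ℂ K] [CompleteSpace K] {V : H →L[ℂ] K}

/-- The homomorphism `X ↦ V X V*` for an isometry `V`. -/
def dilation (hV : adjoint V ∘L V = ContinuousLinearMap.id ℂ H) :
    (H →L[ℂ] H) →⋆ₙₐ[ℂ] (K →L[ℂ] K) where
  toFun X := V ∘L X ∘L adjoint V
  map_smul' c X := by ext; simp
  map_zero' := by ext; simp
  map_add' X Y := by ext; simp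
  map_mul' X Y := by
    ext x
    have h1 : ∀ y, adjoint V (V y) = y := fun y => congrFun (congrArg DFunLike.coe hV) y
    simp [h1]
  map_star' X := by
    simp only [star_eq_adjoint, adjoint_comp, adjoint_adjoint, comp_assoc]

lemma dilation_injective (hV : adjoint V ∘L V = ContinuousLinearMap.id ℂ H) :
    Function.Injective (dilation hV) := by
  intro X Y hXY
  have h1 : ∀ y, adjoint V (V y) = y := fun y => congrFun (congrArg DFunLike.coe hV) y
  ext x
  have h2 : V (X (adjoint V (V x))) = V (Y (adjoint V (V x))) :=
    congrFun (congrArg DFunLike.coe hXY) (V x)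
  rw [h1] at h2
  rw [← h1 (X x), h2, h1]

/-- An injective homomorphism of C⋆-algebras reflects positivity. -/
lemma nonneg_of_map_nonneg {A B : Type*} [NonUnitalCStarAlgebra A] [PartialOrder A]
    [StarOrderedRing A] [NonUnitalCStarAlgebra B] [PartialOrder B] [StarOrderedRing B]
    (π : A →⋆ₙₐ[ℂ] B) (hπ : Function.Injective π) {a : A} (ha : 0 ≤ π a) : 0 ≤ a := by
  rw [CStarAlgebra.nonneg_iff_isSelfAdjoint_and_negPart_eq_zero] at ha ⊢
  have hsa : IsSelfAdjoint a := hπ ((map_star π a).trans ha.1)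
  have hc : Continuous π := AddMonoidHomClass.continuous_of_bound π 1 fun x => by
    rw [one_mul]; exact NonUnitalStarAlgHom.norm_apply_le π x
  refine ⟨hsa, hπ ?_⟩
  -- The negative part is given by the continuous functional calculus, with which `π` commutes.
  rw [map_zero, ← ha.2, CFC.negPart_def, CFC.negPart_def]
  exact NonUnitalStarAlgHomClass.map_cfcₙ (S := ℂ) π _ a (by fun_prop) (by simp) hc hsa ha.1

/-- `V` links two different spaces, so the compression is not a conjugation inside one algebra.
Applying the injective `dilation` entrywise turns it into conjugation of `M` by the diagonal matrix
of `V V*`, which preserves positivity, and the dilation reflects it. -/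
lemma compression_nonneg (hV : adjoint V ∘L V = ContinuousLinearMap.id ℂ H)
    (E : (K →L[ℂ] K) →ₗ[ℂ] (H →L[ℂ] H)) (hE : ∀ X, E X = adjoint V ∘L X ∘L V) {k : ℕ}
    {M : CStarMatrix (Fin k) (Fin k) (K →L[ℂ] K)} (hM : 0 ≤ M) : 0 ≤ M.map E := by
  refine nonneg_of_map_nonneg (CStarMatrix.mapₙₐ (dilation hV)) ?_ ?_
  · intro S T hST
    ext1 i j
    exact dilation_injective hV (congrFun (congrFun hST i) j)
  · let W : CStarMatrix (Fin k) (Fin k) (K →L[ℂ] K) :=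
      CStarMatrix.ofMatrix (Matrix.diagonal fun _ => V ∘L adjoint V)
    have hW : ∀ i j, W i j = if i = j then V ∘L adjoint V else 0 := fun i j =>
      Matrix.diagonal_apply _ i j
    have h1 := star_right_conjugate_nonneg hM W
    convert! h1 using 1
    ext1 i j
    rw [CStarMatrix.mul_apply]
    simp only [CStarMatrix.mul_apply, CStarMatrix.star_apply, hW]
    have h2 : star (V ∘L adjoint V) = V ∘L adjoint V := by
      rw [star_eq_adjoint, adjoint_comp, adjoint_adjoint]
    simp only [ite_mul, zero_mul, Finset.sum_ite_eq, Finset.mem_univ, if_true, apply_ite star, h2,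
      star_zero, mul_ite, mul_zero]
    change V ∘L E (M i j) ∘L adjoint V = _
    rw [hE]
    rfl

end Compression

/-! ### The anti-Wick quantization -/

section AntiWickQuantization
open ContinuousLinearMap
variable {h : Type*} [NormedAddCommGroup h] [InnerProductSpace ℂ h]

lemma adjoint_vacuumEmbedding_comp :
    adjoint (vacuumEmbedding h) ∘L vacuumEmbedding h = ContinuousLinearMap.id ℂ (Fock h) := by
  ext1 v
  refine ext_inner_left ℂ fun u => ?_
  rw [ContinuousLinearMap.comp_apply, adjoint_inner_right]
  change ⟪pureTensor u (vacuum h), pureTensor v (vacuum h)⟫_ℂ = ⟪u, v⟫_ℂ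
  rw [inner_pureTensor, ← expVec_zero, inner_expVec]
  simp

lemma exists_completelyPositive_antiWick
    (Φ : boundedMeasurable (ClassicalField h) →⋆ₐ[ℂ] (DoubleFock h →L[ℂ] DoubleFock h)) :
    ∃ Ψ : boundedMeasurable (ClassicalField h) →CP (Fock h →L[ℂ] Fock h),
      Ψ.toLinearMap = antiWick Φ := by
  refine ⟨{ antiWick Φ with map_cstarMatrix_nonneg' := fun k M hM => ?_ }, rfl⟩
  have h1 : 0 ≤ M.map Φ := CompletelyPositiveMapClass.map_cstarMatrix_nonneg' Φ k M hM
  exact compression_nonneg adjoint_vacuumEmbedding_comp (vacuumExpectation h) (fun X => rfl) h1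

end AntiWickQuantization

/-! ### The main theorem -/

section Main
open MeasureTheory
variable {h : Type*} [NormedAddCommGroup h] [InnerProductSpace ℂ h] [CompleteSpace h]

theorem existsUnique_fieldCalculus {J : h →ₗ⋆[ℂ] h} (hJ : ∀ φ, J (J φ) = φ)
    (hJi : ∀ φ ψ, ⟪J φ, J ψ⟫_ℂ = ⟪ψ, φ⟫_ℂ) :
    ∃! Φ : boundedMeasurable (ClassicalField h) →⋆ₐ[ℂ] (DoubleFock h →L[ℂ] DoubleFock h),
      IsFieldCalculus J Φ := by
  obtain ⟨s, U, z, hU⟩ := exists_gaussian_representation hJ hJi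
  obtain ⟨T, hT, hTz⟩ := exists_sampling z
  refine ⟨_, isFieldCalculus_conj_mulRep hU hT hTz, fun Φ hΦ => ?_⟩
  let e := U.conjStarAlgEquiv
  -- The competing calculus is moved to the Gaussian model, where `eq_mulRep` identifies it.
  let P : boundedMeasurable (ClassicalField h) →⋆ₐ[ℂ]
      (Lp ℂ 2 (gaussField s) →L[ℂ] Lp ℂ 2 (gaussField s)) :=
    ((e.symm : (DoubleFock h →L[ℂ] DoubleFock h) →⋆ₐ[ℂ]
      (Lp ℂ 2 (gaussField s) →L[ℂ] Lp ℂ 2 (gaussField s)))).comp Φ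
  have hP : ∀ f x, P f x = U.symm (Φ f (U x)) := fun f x => rfl
  have h1 : P = mulRep hT := by
    refine eq_mulRep (fun f g C hC hfg u => ?_) hT fun φ f g hfg x => ?_
    · exact (U.symm.continuous.tendsto _).comp (hΦ.tendsto f g C hC hfg (U u))
    · have h2 := (fieldZ_eq_iff hU φ _ _).1 (hΦ.field φ f g hfg (U x))
      have h3 : (U (P f x), U (P g x)) ∈ fieldGraph J φ := by
        rw [hP, hP, U.apply_symm_apply, U.apply_symm_apply]
        exact h2
      filter_upwards [(hU φ _ _).1 h3, hTz φ] with ω h4 h5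
      rw [h4, h5]
  ext1 f
  rw [← h1]
  exact (e.apply_symm_apply (Φ f)).symm

end Main

end
end AntiWick

theorem mainTheorem3 {h : Type*} [NormedAddCommGroup h] [InnerProductSpace ℂ h] [CompleteSpace h]
    [TopologicalSpace.SeparableSpace h] (J : h →ₗ⋆[ℂ] h) (hJ : ∀ φ, J (J φ) = φ)
    (hJ_inner : ∀ φ ψ, ⟪J φ, J ψ⟫_ℂ = ⟪ψ, φ⟫_ℂ) :
    (∃! Φ : AntiWick.boundedMeasurable (AntiWick.ClassicalField h) →⋆ₐ[ℂ]
        (AntiWick.DoubleFock h →L[ℂ] AntiWick.DoubleFock h), AntiWick.IsFieldCalculus J Φ) ∧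
      ∀ Φ : AntiWick.boundedMeasurable (AntiWick.ClassicalField h) →⋆ₐ[ℂ]
        (AntiWick.DoubleFock h →L[ℂ] AntiWick.DoubleFock h), AntiWick.IsFieldCalculus J Φ →
        ∃ Ψ : AntiWick.boundedMeasurable (AntiWick.ClassicalField h) →CP
            (AntiWick.Fock h →L[ℂ] AntiWick.Fock h),
          Ψ.toLinearMap = AntiWick.antiWick Φ :=
  ⟨AntiWick.existsUnique_fieldCalculus hJ hJ_inner,
    fun Φ _ => AntiWick.exists_completelyPositive_antiWick Φ⟩
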